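/- Let $\beta, \epsilon \in (0,1)$ be fixed, and let $$C_1 = \log(1-\beta) - \log\log 4 - \gamma - \sum_{k=2}^{\infty}\sum_{p}\frac{\log p}{p^k} - 1,$$ where $\gamma$ is the Euler--Mascheroni constant and $p$ runs over the primes. Then for all sufficiently large real $T$, $$\max_{T^{\beta}\leqslant t\leqslant T}\left(-\operatorname{Re}\frac{\zeta'}{\zeta}(1+it)\right)\geqslant \log\log T+\log\log\log T+C_1-\epsilon,$$ where $\zeta$ is the Riemann zeta function. In particular, for all sufficiently large $T$, $$\max_{T^{\beta}\leqslant t\leqslant T}\left|\frac{\zeta'}{\zeta}(1+it)\right|\geqslant \log\log T+\log\log\log T+C_1-\epsilon.$$ -/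

import Mathlib

/-- The double series `∑_{k ≥ 2} ∑_p (log p) / p ^ k`, where `p` runs over the primes
(`k` is shifted by two; all terms are nonnegative and the series converges). -/
noncomputable def primePowerLogSum : ℝ :=
  ∑' k : ℕ, ∑' p : Nat.Primes, Real.log ((p : ℕ) : ℝ) / ((p : ℕ) : ℝ) ^ (k + 2)

/-- The constant
`C₁ = log (1 - β) - log log 4 - γ - ∑_{k ≥ 2} ∑_p (log p) / p ^ k - 1`. -/
noncomputable def zetaConst (β : ℝ) : ℝ :=
  Real.log (1 - β) - Real.log (Real.log 4) - Real.eulerMascheroniConstant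
    - primePowerLogSum - 1

/-- The logarithmic derivative of the Riemann zeta function at the point `1 + i t`. -/
noncomputable def zetaLogDerivOneLine (t : ℝ) : ℂ :=
  deriv riemannZeta (1 + Complex.I * (t : ℂ)) / riemannZeta (1 + Complex.I * (t : ℂ))

/-!
The proof is the resonance method, run so that no information on `ζ` beyond its non-vanishing on
`Re s = 1` and the Dirichlet series of `ζ'/ζ` in `Re s > 1` is needed.

For `σ > 1` put `f(t) = -Re ζ'/ζ(σ + it) = ∑ Λ(n) n^{-σ} cos (t log n)`. The resonator is
`R(t) = ∏_{p ≤ N} P_{q_p}(t log p)` with `P_q` the Poisson kernel and `q_p = 1 - p / N`; it is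
nonnegative with nonnegative Fourier coefficients. Multiplying a weight by a Poisson kernel inverts
a second-order difference operator on cosine transforms (`cosTransform_mul_poissonKer`), so a
minimum principle (`nonneg_of_poisson_recurrence`) gives everything required: nonnegative cosine
transforms stay nonnegative, upper bounds grow by at most `(1 + q) / (1 - q)`, and moving the
frequency by `log p` costs at most a factor `q_p`. Against the triangular weight of length `T`,
whose cosine transform is a nonnegative Fejér kernel, this yields

* `∫ f R ≥ (∑_{n ≤ N} Λ(n) n^{-σ} (1 - n / N)) ∫ R`, as each prime power `n = p ^ k` is amplified by
  `q_p ^ k ≥ 1 - n / N` (`sum_mul_integral_resonator_le`);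
* `0 ≤ ∫ f R ≤ C V ∏ (1 + q_p) / (1 - q_p)` against the triangular weight of length `V`, as
  Chebyshev's bound controls `∑ Λ(n) n^{-σ} / (1 + (log n - l)²)` uniformly in `l` and `σ`.

A combination of triangular weights that vanishes on `[0, U]`, `U = T ^ β`, then isolates the range
`[U, T]`: the second bound shows that removing `[0, U]`, with the pole of `ζ` inside, is harmless as
long as `∏ (1 + q_p) / (1 - q_p) ≤ T ^ ρ` with `ρ < 1 - β`. Letting `σ → 1` for fixed `T` is a
compactness argument (`exists_le_negReLogDeriv_one`).

It remains to estimate two sums over primes. The prime number theorem would give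
`∑_{n ≤ N} Λ(n) / n · (1 - n / N) = log N - γ - 1 + o(1)` and
`∑_{p ≤ N} log ((2 N - p) / p) ∼ N log 4 / log N`. Keeping all prime powers gains the constant
`∑_{k ≥ 2} ∑_p log p / p ^ k ≈ 0.755` over the claim, which is enough to replace both asymptotics by
elementary bounds: the lower bound `log N - 2 + (3 / 20) log 2 - o(1)`, from
`∑_{n ≤ m} Λ(n) ⌊m / n⌋ = log m!` together with part of the discarded fractional parts
(`log_sub_le_sum_vonMangoldt_mul`), and the upper bound `(1 + o(1)) N (log 4)² / log N`, from
`θ(x) ≤ x log 4` (`eventually_sum_primesTo_log_le`). The losses are compared with the gain in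
`log_log_four_add_one_sub_le`.
-/

/-! ### Cosine transforms and Poisson kernels -/

section CosineTransform

open Real intervalIntegral

/-- The cosine transform `∫₀ᵀ W(t) cos(l t) dt` of a weight `W` on `[0, T]`. -/
noncomputable def cosTransform (T : ℝ) (W : ℝ → ℝ) (l : ℝ) : ℝ :=
  ∫ t in (0 : ℝ)..T, W t * cos (l * t)

/-- The Poisson kernel `(1 - q²) / |1 - q e^{iθ}|² = ∑_{k ∈ ℤ} q^{|k|} cos (k θ)`. -/
noncomputable def poissonKer (q θ : ℝ) : ℝ :=
  (1 - q ^ 2) / (1 - 2 * q * cos θ + q ^ 2)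

lemma poissonKer_denom_pos {q : ℝ} (hq0 : 0 ≤ q) (hq1 : q < 1) (θ : ℝ) :
    0 < 1 - 2 * q * cos θ + q ^ 2 := by
  have := cos_le_one θ
  nlinarith [mul_nonneg hq0 (sub_nonneg.2 this), sq_pos_of_pos (sub_pos.2 hq1)]

lemma poissonKer_nonneg {q : ℝ} (hq0 : 0 ≤ q) (hq1 : q < 1) (θ : ℝ) : 0 ≤ poissonKer q θ :=
  div_nonneg (by nlinarith) (poissonKer_denom_pos hq0 hq1 θ).le

lemma continuous_poissonKer {q : ℝ} (hq0 : 0 ≤ q) (hq1 : q < 1) (a : ℝ) :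
    Continuous fun t : ℝ => poissonKer q (a * t) := by
  unfold poissonKer
  exact Continuous.div (by fun_prop) (by fun_prop)
    fun t => (poissonKer_denom_pos hq0 hq1 _).ne'

lemma exists_abs_cosTransform_le {T : ℝ} (hT : 0 ≤ T) {W : ℝ → ℝ} (hW : Continuous W) :
    ∃ B, ∀ l, |cosTransform T W l| ≤ B := by
  refine ⟨∫ t in (0 : ℝ)..T, |W t|, fun l => ?_⟩
  refine (abs_integral_le_integral_abs hT).trans ?_
  refine integral_mono_on hT (Continuous.intervalIntegrable (by fun_prop) _ _)
    (Continuous.intervalIntegrable (by fun_prop) _ _) fun t _ => ?_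
  rw [abs_mul]
  exact mul_le_of_le_one_right (abs_nonneg _) (abs_cos_le_one _)

/-- Multiplying a weight by a Poisson kernel acts on cosine transforms as the inverse of the
second-order difference operator `u ↦ (1 + q²) u - q (u(· + a) + u(· - a))`. -/
lemma cosTransform_mul_poissonKer {T q : ℝ} (hq0 : 0 ≤ q) (hq1 : q < 1) {W : ℝ → ℝ}
    (hW : Continuous W) (a l : ℝ) :
    (1 + q ^ 2) * cosTransform T (fun t => W t * poissonKer q (a * t)) l
      - q * (cosTransform T (fun t => W t * poissonKer q (a * t)) (l + a)
        + cosTransform T (fun t => W t * poissonKer q (a * t)) (l - a))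
      = (1 - q ^ 2) * cosTransform T W l := by
  have hP := continuous_poissonKer hq0 hq1 a
  have hi : ∀ m : ℝ, IntervalIntegrable
      (fun t => W t * poissonKer q (a * t) * cos (m * t)) MeasureTheory.volume 0 T :=
    fun m => Continuous.intervalIntegrable (by fun_prop) _ _
  unfold cosTransform
  rw [← integral_add (hi _) (hi _), ← integral_const_mul, ← integral_const_mul,
    ← integral_const_mul, ← integral_sub ((hi _).const_mul _) (((hi _).add (hi _)).const_mul _)]
  refine integral_congr fun t _ => ?_
  have hd := (poissonKer_denom_pos hq0 hq1 (a * t)).ne'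
  have hc : cos ((l + a) * t) + cos ((l - a) * t) = 2 * cos (l * t) * cos (a * t) := by
    rw [add_mul, sub_mul, cos_add, cos_sub]; ring
  have hP' : poissonKer q (a * t) * (1 - 2 * q * cos (a * t) + q ^ 2) = 1 - q ^ 2 :=
    div_mul_cancel₀ _ hd
  linear_combination (-q * W t * poissonKer q (a * t)) * hc + W t * cos (l * t) * hP'

/-- Minimum principle for the difference operator inverted by the Poisson kernel. -/
lemma nonneg_of_poisson_recurrence {q : ℝ} (hq0 : 0 ≤ q) (hq1 : q < 1) {a B : ℝ} {u v : ℝ → ℝ}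
    (hB : ∀ l, B ≤ u l)
    (h : ∀ l, (1 + q ^ 2) * u l - q * (u (l + a) + u (l - a)) = (1 - q ^ 2) * v l)
    (hv : ∀ l, 0 ≤ v l) (l : ℝ) : 0 ≤ u l := by
  have hbdd : BddBelow (Set.range u) := ⟨B, by rintro _ ⟨x, rfl⟩; exact hB x⟩
  have hm : ∀ x, (⨅ y, u y) ≤ u x := fun x => ciInf_le hbdd x
  have key : 2 * q * (⨅ y, u y) / (1 + q ^ 2) ≤ ⨅ y, u y := by
    refine le_ciInf fun x => ?_
    rw [div_le_iff₀ (by positivity)]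
    have h1 := mul_le_mul_of_nonneg_left (hm (x + a)) hq0
    have h2 := mul_le_mul_of_nonneg_left (hm (x - a)) hq0
    have h3 : 0 ≤ (1 - q ^ 2) * v x := mul_nonneg (by nlinarith) (hv x)
    linarith [h x]
  rw [div_le_iff₀ (by positivity)] at key
  have h4 : 0 ≤ (1 - q) ^ 2 * (⨅ y, u y) := by linarith
  exact ((mul_nonneg_iff_of_pos_left (pow_pos (sub_pos.2 hq1) 2)).1 h4).trans (hm l)

section Step

variable {T q : ℝ} {W : ℝ → ℝ}

lemma cosTransform_mul_poissonKer_nonneg (hT : 0 ≤ T) (hq0 : 0 ≤ q) (hq1 : q < 1)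
    (hW : Continuous W) (a : ℝ) (h : ∀ l, 0 ≤ cosTransform T W l) (l : ℝ) :
    0 ≤ cosTransform T (fun t => W t * poissonKer q (a * t)) l := by
  obtain ⟨B, hB⟩ : ∃ B, ∀ l, |cosTransform T (fun t => W t * poissonKer q (a * t)) l| ≤ B :=
    exists_abs_cosTransform_le hT (hW.mul (continuous_poissonKer hq0 hq1 a))
  exact nonneg_of_poisson_recurrence hq0 hq1 (fun l => (abs_le.1 (hB l)).1)
    (cosTransform_mul_poissonKer hq0 hq1 hW a) h l

lemma cosTransform_mul_poissonKer_le (hT : 0 ≤ T) (hq0 : 0 ≤ q) (hq1 : q < 1)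
    (hW : Continuous W) (a : ℝ) {c : ℝ} (h : ∀ l, cosTransform T W l ≤ c) (l : ℝ) :
    cosTransform T (fun t => W t * poissonKer q (a * t)) l ≤ c * ((1 + q) / (1 - q)) := by
  obtain ⟨B, hB⟩ : ∃ B, ∀ l, |cosTransform T (fun t => W t * poissonKer q (a * t)) l| ≤ B :=
    exists_abs_cosTransform_le hT (hW.mul (continuous_poissonKer hq0 hq1 a))
  have hq : 1 - q ≠ 0 := (sub_pos.2 hq1).ne'
  have := nonneg_of_poisson_recurrence hq0 hq1 (a := a) (B := c * ((1 + q) / (1 - q)) - B)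
    (u := fun l => c * ((1 + q) / (1 - q))
      - cosTransform T (fun t => W t * poissonKer q (a * t)) l)
    (v := fun l => c - cosTransform T W l) (fun l => by linarith [(abs_le.1 (hB l)).2])
    (fun l => by
      have h1 := cosTransform_mul_poissonKer (T := T) hq0 hq1 hW a l
      have h2 : (1 - q) ^ 2 * (c * ((1 + q) / (1 - q))) = (1 - q ^ 2) * c := by
        field_simp; ring
      linear_combination h2 - h1)
    (fun l => sub_nonneg.2 (h l)) l
  linarith

/-- Shifting the frequency by that of the Poisson kernel costs at most a factor `q`. -/
lemma mul_cosTransform_le_cosTransform_add (hT : 0 ≤ T) (hq0 : 0 ≤ q) (hq1 : q < 1)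
    (hW : Continuous W) (a : ℝ) (h : ∀ l, 0 ≤ cosTransform T W l) (l : ℝ) :
    q * cosTransform T (fun t => W t * poissonKer q (a * t)) l
      ≤ cosTransform T (fun t => W t * poissonKer q (a * t)) (l + a) := by
  obtain ⟨B, hB⟩ : ∃ B, ∀ l, |cosTransform T (fun t => W t * poissonKer q (a * t)) l| ≤ B :=
    exists_abs_cosTransform_le hT (hW.mul (continuous_poissonKer hq0 hq1 a))
  set u := cosTransform T (fun t => W t * poissonKer q (a * t)) with hu
  -- The recurrence factors: `v l = u (l + a) - q u l` satisfies `q v l ≤ v (l - a)`.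
  have hbdd : BddBelow (Set.range fun l => u (l + a) - q * u l) := by
    refine ⟨-B - q * B, ?_⟩
    rintro _ ⟨x, rfl⟩
    have h1 := (abs_le.1 (hB (x + a))).1
    have h2 := mul_le_mul_of_nonneg_left (abs_le.1 (hB x)).2 hq0
    simp only; linarith
  have hm : ∀ x, (⨅ y, (u (y + a) - q * u y)) ≤ u (x + a) - q * u x := fun x => ciInf_le hbdd x
  have key : q * (⨅ y, (u (y + a) - q * u y)) ≤ ⨅ y, (u (y + a) - q * u y) := by
    refine le_ciInf fun x => ?_
    have h1 := cosTransform_mul_poissonKer (T := T) hq0 hq1 hW a (x + a)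
    rw [← hu, add_sub_cancel_right] at h1
    have h2 := mul_le_mul_of_nonneg_left (hm (x + a)) hq0
    have h3 : 0 ≤ (1 - q ^ 2) * cosTransform T W (x + a) := mul_nonneg (by nlinarith) (h _)
    linarith
  have h4 : 0 ≤ (1 - q) * ⨅ y, (u (y + a) - q * u y) := by linarith
  have h5 := (mul_nonneg_iff_of_pos_left (sub_pos.2 hq1)).1 h4
  linarith [hm l]

lemma cosTransform_le_cosTransform_mul_poissonKer (hT : 0 ≤ T) (hq0 : 0 ≤ q) (hq1 : q < 1)
    (hW : Continuous W) (a : ℝ) (h : ∀ l, 0 ≤ cosTransform T W l) (l : ℝ) :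
    cosTransform T W l ≤ cosTransform T (fun t => W t * poissonKer q (a * t)) l := by
  have h1 := mul_cosTransform_le_cosTransform_add hT hq0 hq1 hW a h l
  have h2 := mul_cosTransform_le_cosTransform_add hT hq0 hq1 hW (-a) h l
  simp only [poissonKer, neg_mul, cos_neg] at h2
  simp only [← poissonKer.eq_1, ← sub_eq_add_neg] at h2
  have h3 := cosTransform_mul_poissonKer (T := T) hq0 hq1 hW a l
  have h1' := mul_le_mul_of_nonneg_left h1 hq0
  have h2' := mul_le_mul_of_nonneg_left h2 hq0
  have : (1 - q ^ 2) * cosTransform T W l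
      ≤ (1 - q ^ 2) * cosTransform T (fun t => W t * poissonKer q (a * t)) l := by
    rw [← h3]; nlinarith
  exact le_of_mul_le_mul_left this (by nlinarith)

end Step

/-- The resonator: the product over `p ∈ S` of the Poisson kernels of parameter `q p` and
frequency `log p`. -/
noncomputable def resonator (S : Finset ℕ) (q : ℕ → ℝ) (t : ℝ) : ℝ :=
  ∏ p ∈ S, poissonKer (q p) (log p * t)

variable {T : ℝ} {W : ℝ → ℝ} {S : Finset ℕ} {q : ℕ → ℝ}

lemma continuous_resonator (hq : ∀ p ∈ S, 0 ≤ q p ∧ q p < 1) : Continuous (resonator S q) := by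
  unfold resonator
  exact continuous_finsetProd _ fun p hp => continuous_poissonKer (hq p hp).1 (hq p hp).2 _

lemma resonator_nonneg (hq : ∀ p ∈ S, 0 ≤ q p ∧ q p < 1) (t : ℝ) : 0 ≤ resonator S q t :=
  Finset.prod_nonneg fun p hp => poissonKer_nonneg (hq p hp).1 (hq p hp).2 _

lemma mul_resonator_insert {p : ℕ} (hp : p ∉ S) :
    (fun t => W t * resonator (insert p S) q t)
      = fun t => W t * resonator S q t * poissonKer (q p) (log p * t) := by
  ext t
  rw [resonator, Finset.prod_insert hp, resonator]
  ring

lemma cosTransform_resonator_nonneg (hT : 0 ≤ T) (hW : Continuous W)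
    (hq : ∀ p ∈ S, 0 ≤ q p ∧ q p < 1) (h : ∀ l, 0 ≤ cosTransform T W l) (l : ℝ) :
    0 ≤ cosTransform T (fun t => W t * resonator S q t) l := by
  induction S using Finset.induction_on generalizing l with
  | empty => simpa [resonator] using h l
  | insert p S hp ih =>
    have hS : ∀ p ∈ S, 0 ≤ q p ∧ q p < 1 := fun r hr => hq r (Finset.mem_insert_of_mem hr)
    have hp' := hq p (Finset.mem_insert_self _ _)
    rw [mul_resonator_insert hp]
    exact cosTransform_mul_poissonKer_nonneg hT hp'.1 hp'.2 (hW.mul (continuous_resonator hS)) _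
      (ih hS) l

lemma cosTransform_resonator_le (hT : 0 ≤ T) (hW : Continuous W)
    (hq : ∀ p ∈ S, 0 ≤ q p ∧ q p < 1) {c : ℝ} (h : ∀ l, cosTransform T W l ≤ c) (l : ℝ) :
    cosTransform T (fun t => W t * resonator S q t) l
      ≤ c * ∏ p ∈ S, ((1 + q p) / (1 - q p)) := by
  induction S using Finset.induction_on generalizing l with
  | empty => simpa [resonator] using h l
  | insert p S hp ih =>
    have hS : ∀ p ∈ S, 0 ≤ q p ∧ q p < 1 := fun r hr => hq r (Finset.mem_insert_of_mem hr)
    have hp' := hq p (Finset.mem_insert_self _ _)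
    rw [mul_resonator_insert hp, Finset.prod_insert hp, mul_comm ((1 + q p) / (1 - q p)),
      ← mul_assoc]
    exact cosTransform_mul_poissonKer_le hT hp'.1 hp'.2 (hW.mul (continuous_resonator hS)) _
      (ih hS) l

lemma cosTransform_le_cosTransform_resonator (hT : 0 ≤ T) (hW : Continuous W)
    (hq : ∀ p ∈ S, 0 ≤ q p ∧ q p < 1) (h : ∀ l, 0 ≤ cosTransform T W l) (l : ℝ) :
    cosTransform T W l ≤ cosTransform T (fun t => W t * resonator S q t) l := by
  induction S using Finset.induction_on generalizing l with
  | empty => simp [resonator]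
  | insert p S hp ih =>
    have hS : ∀ p ∈ S, 0 ≤ q p ∧ q p < 1 := fun r hr => hq r (Finset.mem_insert_of_mem hr)
    have hp' := hq p (Finset.mem_insert_self _ _)
    rw [mul_resonator_insert hp]
    exact (ih hS l).trans (cosTransform_le_cosTransform_mul_poissonKer hT hp'.1 hp'.2
      (hW.mul (continuous_resonator hS)) _ (cosTransform_resonator_nonneg hT hW hS h) l)

lemma pow_mul_cosTransform_resonator_le (hT : 0 ≤ T) (hW : Continuous W)
    (hq : ∀ p ∈ S, 0 ≤ q p ∧ q p < 1) (h : ∀ l, 0 ≤ cosTransform T W l) {p : ℕ} (hp : p ∈ S)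
    (k : ℕ) :
    q p ^ k * cosTransform T (fun t => W t * resonator S q t) 0
      ≤ cosTransform T (fun t => W t * resonator S q t) (log ((p ^ k : ℕ) : ℝ)) := by
  have hS : ∀ r ∈ S.erase p, 0 ≤ q r ∧ q r < 1 := fun r hr => hq r (Finset.mem_of_mem_erase hr)
  have hp' := hq p hp
  have step := mul_cosTransform_le_cosTransform_add (W := fun t => W t * resonator (S.erase p) q t)
    hT hp'.1 hp'.2
    (hW.mul (continuous_resonator hS)) (log p) (cosTransform_resonator_nonneg hT hW hS h)
  rw [← mul_resonator_insert (Finset.notMem_erase p S), Finset.insert_erase hp] at step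
  rw [Nat.cast_pow, log_pow]
  induction k with
  | zero => simp
  | succ k ih =>
    have h1 := mul_le_mul_of_nonneg_left ih hp'.1
    have h2 := step (k * log p)
    rw [show ((k + 1 : ℕ) : ℝ) * log p = k * log p + log p by push_cast; ring, pow_succ']
    linarith

end CosineTransform

/-! ### Triangular weights -/

section TriangularWeight

open Real intervalIntegral

/-- The triangular weight `max 0 (1 - t / V)`. -/
noncomputable def triWeight (V t : ℝ) : ℝ := max 0 (1 - t / V)

lemma continuous_triWeight (V : ℝ) : Continuous (triWeight V) := by
  unfold triWeight; fun_prop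

lemma triWeight_nonneg (V t : ℝ) : 0 ≤ triWeight V t := le_max_left _ _

lemma triWeight_of_le {V t : ℝ} (hV : 0 < V) (ht : t ≤ V) : triWeight V t = 1 - t / V :=
  max_eq_right (sub_nonneg.2 ((div_le_one hV).2 ht))

lemma triWeight_of_ge {V t : ℝ} (hV : 0 < V) (ht : V ≤ t) : triWeight V t = 0 :=
  max_eq_left (sub_nonpos.2 ((one_le_div hV).2 ht))

lemma cosTransform_triWeight_eq {V T : ℝ} (hV : 0 < V) (hVT : V ≤ T) (l : ℝ) :
    cosTransform T (triWeight V) l = ∫ t in (0 : ℝ)..V, (1 - t / V) * cos (l * t) := by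
  have hc := continuous_triWeight V
  have hi : ∀ a b, IntervalIntegrable (fun t => triWeight V t * cos (l * t))
      MeasureTheory.volume a b := fun a b => Continuous.intervalIntegrable (by fun_prop) _ _
  rw [cosTransform, ← integral_add_adjacent_intervals (hi 0 V) (hi V T)]
  have h0 : ∫ t in V..T, triWeight V t * cos (l * t) = 0 := by
    refine (integral_congr fun t ht => ?_).trans integral_zero
    rw [Set.uIcc_of_le hVT] at ht
    simp only [triWeight_of_ge hV ht.1, zero_mul]
  rw [h0, add_zero]
  refine integral_congr fun t ht => ?_
  rw [Set.uIcc_of_le hV.le] at ht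
  simp only [triWeight_of_le hV ht.2]

lemma cosTransform_triWeight_zero {V T : ℝ} (hV : 0 < V) (hVT : V ≤ T) :
    cosTransform T (triWeight V) 0 = V / 2 := by
  rw [cosTransform_triWeight_eq hV hVT]
  simp only [zero_mul, cos_zero, mul_one]
  rw [integral_sub (by simp) (Continuous.intervalIntegrable (by fun_prop) _ _),
    integral_div, integral_id, integral_const]
  simp only [smul_eq_mul]
  field_simp
  ring

lemma cosTransform_triWeight_of_ne {V T : ℝ} (hV : 0 < V) (hVT : V ≤ T) {l : ℝ} (hl : l ≠ 0) :
    cosTransform T (triWeight V) l = (1 - cos (l * V)) / (V * l ^ 2) := by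
  rw [cosTransform_triWeight_eq hV hVT]
  have hd : ∀ t ∈ Set.uIcc 0 V, HasDerivAt
      (fun t => (1 - t / V) * (sin (l * t) / l) - cos (l * t) / (V * l ^ 2))
      ((1 - t / V) * cos (l * t)) t := by
    intro t _
    have h1 : HasDerivAt (fun t : ℝ => l * t) l t := by
      simpa using (hasDerivAt_id t).const_mul l
    have h2 : HasDerivAt (fun t : ℝ => 1 - t / V) (-(1 / V)) t := by
      simpa using ((hasDerivAt_id t).div_const V).const_sub 1
    refine ((h2.mul (h1.sin.div_const l)).sub (h1.cos.div_const (V * l ^ 2))).congr_deriv ?_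
    field_simp
    ring
  rw [integral_eq_sub_of_hasDerivAt hd (Continuous.intervalIntegrable (by fun_prop) _ _)]
  simp [div_self hV.ne']
  ring

lemma cosTransform_triWeight_nonneg {V T : ℝ} (hV : 0 < V) (hVT : V ≤ T) (l : ℝ) :
    0 ≤ cosTransform T (triWeight V) l := by
  rcases eq_or_ne l 0 with rfl | hl
  · rw [cosTransform_triWeight_zero hV hVT]; positivity
  · rw [cosTransform_triWeight_of_ne hV hVT hl]
    exact div_nonneg (sub_nonneg.2 (cos_le_one _)) (by positivity)

lemma cosTransform_triWeight_le {V T : ℝ} (hV : 1 ≤ V) (hVT : V ≤ T) (l : ℝ) :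
    cosTransform T (triWeight V) l ≤ 5 * V / (1 + l ^ 2) := by
  have hV0 : 0 < V := by linarith
  rcases eq_or_ne l 0 with rfl | hl
  · rw [cosTransform_triWeight_zero hV0 hVT]; norm_num; linarith
  rw [cosTransform_triWeight_of_ne hV0 hVT hl]
  have hl2 : 0 < l ^ 2 := by positivity
  rw [div_le_div_iff₀ (by positivity) (by positivity)]
  have hc : 1 - cos (l * V) ≤ 2 := by linarith [neg_one_le_cos (l * V)]
  have hc' : 1 - cos (l * V) ≤ (l * V) ^ 2 / 2 := by linarith [one_sub_sq_div_two_le_cos (x := l * V)]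
  rcases le_total (l ^ 2) 4 with h | h
  · calc (1 - cos (l * V)) * (1 + l ^ 2) ≤ (l * V) ^ 2 / 2 * 5 := by
          gcongr; linarith
      _ ≤ 5 * V * (V * l ^ 2) := by nlinarith [mul_pos (pow_pos hV0 2) hl2]
  · calc (1 - cos (l * V)) * (1 + l ^ 2) ≤ 2 * (1 + l ^ 2) := by gcongr
      _ ≤ 5 * l ^ 2 := by linarith
      _ ≤ 5 * V * (V * l ^ 2) := by
        have : 1 ≤ V ^ 2 := by nlinarith
        nlinarith [mul_le_mul_of_nonneg_right this hl2.le]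

end TriangularWeight

/-! ### Sums of the von Mangoldt function -/

section PrimeSums

open Real Filter Finset Chebyshev
open ArithmeticFunction hiding log id

lemma one_add_sq_le_three_mul {x y : ℝ} (h : |x - y| ≤ 1) : 1 + y ^ 2 ≤ 3 * (1 + x ^ 2) := by
  have := sq_le_one_iff_abs_le_one (x - y) |>.2 h
  nlinarith [sq_nonneg (2 * x - y)]

lemma summable_inv_one_add_int_sq : Summable fun j : ℤ => 1 / (1 + (j : ℝ) ^ 2) := by
  have h := (Real.summable_one_div_int_pow (p := 2)).2 one_lt_two
  refine Summable.of_norm_bounded_eventually h ?_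
  filter_upwards [(Set.finite_singleton (0 : ℤ)).compl_mem_cofinite] with j hj
  have hj' : (0 : ℝ) < (j : ℝ) ^ 2 := by
    have : (j : ℝ) ≠ 0 := by exact_mod_cast hj
    positivity
  rw [Real.norm_of_nonneg (by positivity)]
  exact one_div_le_one_div_of_le hj' (by linarith)

lemma sum_inv_one_add_sub_sq_le (K : Finset ℕ) (l : ℝ) :
    ∑ k ∈ K, 1 / (1 + ((k : ℝ) - l) ^ 2) ≤ 3 * ∑' j : ℤ, 1 / (1 + (j : ℝ) ^ 2) := by
  have h1 : ∀ k ∈ K, 1 / (1 + ((k : ℝ) - l) ^ 2)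
      ≤ 3 * (1 / (1 + (((k : ℤ) - ⌊l⌋ : ℤ) : ℝ) ^ 2)) := by
    intro k _
    rw [mul_one_div, div_le_div_iff₀ (by positivity) (by positivity), one_mul]
    refine one_add_sq_le_three_mul ?_
    push_cast
    rw [abs_le]
    constructor <;> linarith [Int.floor_le l, Int.lt_floor_add_one l]
  refine (Finset.sum_le_sum h1).trans ?_
  rw [← Finset.mul_sum]
  refine mul_le_mul_of_nonneg_left ?_ (by norm_num)
  have hinj : Function.Injective fun k : ℕ => ((k : ℤ) - ⌊l⌋) := fun a b h => by
    simpa using h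
  refine (le_of_eq (Finset.sum_map K ⟨_, hinj⟩ fun j : ℤ => 1 / (1 + (j : ℝ) ^ 2)).symm).trans ?_
  exact summable_inv_one_add_int_sq.sum_le_tsum _ fun j _ => by positivity

/-- By Chebyshev's bound `ψ(x) ≪ x`, the measure `∑ Λ(n)/n · δ_{log n}` has bounded mass on unit
intervals, uniformly in their position. -/
lemma exists_sum_vonMangoldt_div_mul_le : ∃ B : ℝ, 0 ≤ B ∧ ∀ (s : Finset ℕ) (l : ℝ),
    ∑ n ∈ s, Λ n / n * (1 / (1 + (log n - l) ^ 2)) ≤ B := by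
  set Z := ∑' j : ℤ, 1 / (1 + (j : ℝ) ^ 2) with hZ
  have hZ0 : 0 ≤ Z := tsum_nonneg fun j => by positivity
  have hc : 0 ≤ log 4 + 4 := by positivity
  refine ⟨(log 4 + 4) * exp 1 * 3 * (3 * Z), by positivity, fun s l => ?_⟩
  have hfib := Finset.sum_fiberwise_of_maps_to (s := s) (t := s.image fun n : ℕ => ⌊log n⌋₊)
    (g := fun n : ℕ => ⌊log n⌋₊) (fun n hn => Finset.mem_image_of_mem _ hn)
    (fun n => Λ n / n * (1 / (1 + (log n - l) ^ 2)))
  rw [← hfib]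
  refine (Finset.sum_le_sum (g := fun k : ℕ =>
    (log 4 + 4) * exp 1 * 3 * (1 / (1 + ((k : ℝ) - l) ^ 2))) fun k _ => ?_).trans ?_
  · have hterm : ∀ n ∈ s.filter (fun n : ℕ => ⌊log n⌋₊ = k),
        Λ n / n * (1 / (1 + (log n - l) ^ 2))
          ≤ Λ n * (exp (-k) * (3 * (1 / (1 + ((k : ℝ) - l) ^ 2)))) := by
      intro n hn
      rcases Nat.eq_zero_or_pos n with rfl | hn0
      · simp
      have hlog : 0 ≤ log n := log_natCast_nonneg n
      have hk := (Finset.mem_filter.1 hn).2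
      have hk1 : (k : ℝ) ≤ log n := hk ▸ Nat.floor_le hlog
      have hk2 : log n < k + 1 := hk ▸ Nat.lt_floor_add_one _
      rw [div_eq_mul_inv, mul_assoc]
      refine mul_le_mul_of_nonneg_left ?_ vonMangoldt_nonneg
      refine mul_le_mul ?_ ?_ (by positivity) (exp_pos _).le
      · rw [exp_neg]
        refine inv_anti₀ (exp_pos _) ?_
        calc exp k ≤ exp (log n) := exp_le_exp.2 hk1
          _ = n := exp_log (by exact_mod_cast hn0)
      · rw [mul_one_div, div_le_div_iff₀ (by positivity) (by positivity), one_mul]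
        refine one_add_sq_le_three_mul ?_
        rw [abs_le]; constructor <;> linarith
    refine (Finset.sum_le_sum hterm).trans ?_
    rw [← Finset.sum_mul]
    have hpsi : ∑ n ∈ s.filter (fun n : ℕ => ⌊log n⌋₊ = k), Λ n ≤ ψ (exp (k + 1)) := by
      have hz : ∑ n ∈ s.filter (fun n : ℕ => ⌊log n⌋₊ = k), Λ n
          = ∑ n ∈ (s.filter (fun n : ℕ => ⌊log n⌋₊ = k)).filter (fun n => n ≠ 0), Λ n := by
        refine (Finset.sum_filter_of_ne ?_).symm
        rintro n _ h rfl
        exact h (by simp)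
      rw [hz, psi]
      refine Finset.sum_le_sum_of_subset_of_nonneg (fun n hn => ?_) fun _ _ _ => vonMangoldt_nonneg
      simp only [Finset.mem_filter] at hn
      have hn0 := Nat.pos_of_ne_zero hn.2
      rw [Finset.mem_Ioc]
      refine ⟨hn0, Nat.le_floor ?_⟩
      have hk2 : log n < k + 1 := hn.1.2 ▸ Nat.lt_floor_add_one _
      exact ((log_lt_iff_lt_exp (by exact_mod_cast hn0)).1 hk2).le
    have hpsi2 := hpsi.trans (psi_le_const_mul_self (exp_pos _).le)
    refine (mul_le_mul_of_nonneg_right hpsi2 (by positivity)).trans (le_of_eq ?_)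
    rw [exp_add, exp_neg]
    field_simp
  · rw [← Finset.mul_sum]
    exact mul_le_mul_of_nonneg_left (sum_inv_one_add_sub_sq_le _ _) (by positivity)

lemma sum_vonMangoldt_mul_div_eq_log_factorial (m : ℕ) :
    ∑ n ∈ Ico 1 (m + 1), Λ n * ((m / n : ℕ) : ℝ) = log (m.factorial) := by
  have h := sum_Ioc_mul_zeta_eq_sum (R := ℝ) Λ m
  rw [vonMangoldt_mul_zeta] at h
  have e : Ioc 0 m = Ico 1 (m + 1) := by ext; simp; omega
  rw [e] at h
  rw [← h, ← Finset.prod_Ico_id_eq_factorial, Nat.cast_prod, log_prod]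
  · rfl
  · intro i hi
    have := (Finset.mem_Ico.1 hi).1
    exact_mod_cast (by omega : i ≠ 0)

lemma mul_log_sub_le_log_factorial (m : ℕ) : m * log m - m ≤ log m.factorial := by
  rcases Nat.eq_zero_or_pos m with rfl | hm
  · simp
  have hm' : (0 : ℝ) < m := by exact_mod_cast hm
  have h := log_le_log (by positivity) (pow_div_factorial_le_exp (m : ℝ) hm'.le m)
  rw [log_exp, log_div (by positivity) (by positivity), log_pow] at h
  linarith

lemma sum_inv_Ico_le (n k : ℕ) (hn : 0 < n) :
    ∑ m ∈ Ico n (n + k), (1 : ℝ) / m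
      ≤ log ((n + k : ℕ) : ℝ) - log n + 1 / n - 1 / ((n + k : ℕ) : ℝ) := by
  induction k with
  | zero => simp
  | succ k ih =>
    rw [← add_assoc, Finset.sum_Ico_succ_top (by omega)]
    have hx : (0 : ℝ) < ((n + k : ℕ) : ℝ) := by positivity
    have h := one_sub_inv_le_log_of_pos (x := ((n + k + 1 : ℕ) : ℝ) / ((n + k : ℕ) : ℝ))
      (by positivity)
    rw [log_div (by positivity) hx.ne', inv_div] at h
    have h2 : 1 - ((n + k : ℕ) : ℝ) / ((n + k + 1 : ℕ) : ℝ) = 1 / ((n + k + 1 : ℕ) : ℝ) := by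
      have : ((n + k + 1 : ℕ) : ℝ) ≠ 0 := by positivity
      field_simp
      push_cast; ring
    linarith

/-- The fractional parts discarded when `m / n` is replaced by `⌊m / n⌋` are not negligible on
average: already the block `n ≤ m < 2 n` contributes almost `(1 - log 2) n`. -/
lemma mul_le_sum_mod_div {n N : ℕ} (hn : 74 ≤ n) (hN : 2 * n ≤ N) :
    (3 / 10 : ℝ) * n ≤ ∑ m ∈ Ico n N, ((m % n : ℕ) : ℝ) / m := by
  have hn0 : (0 : ℝ) < n := by positivity
  have h1 : ∑ m ∈ Ico n (n + n), ((m % n : ℕ) : ℝ) / m ≤ ∑ m ∈ Ico n N, ((m % n : ℕ) : ℝ) / m :=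
    Finset.sum_le_sum_of_subset_of_nonneg (Finset.Ico_subset_Ico_right (by omega))
      fun _ _ _ => by positivity
  refine le_trans ?_ h1
  have h2 : ∑ m ∈ Ico n (n + n), ((m % n : ℕ) : ℝ) / m
      = ∑ m ∈ Ico n (n + n), (1 - n * (1 / (m : ℝ))) := by
    refine Finset.sum_congr rfl fun m hm => ?_
    rw [Finset.mem_Ico] at hm
    have : m % n = m - n := by
      rw [Nat.mod_eq_sub_mod hm.1, Nat.mod_eq_of_lt (by omega)]
    rw [this, Nat.cast_sub hm.1]
    have : (m : ℝ) ≠ 0 := by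
      have : m ≠ 0 := by omega
      exact_mod_cast this
    field_simp
  rw [h2, Finset.sum_sub_distrib, ← Finset.mul_sum]
  have h3 := sum_inv_Ico_le n n (by omega)
  have h4 : log ((n + n : ℕ) : ℝ) = log 2 + log n := by
    rw [← log_mul (by norm_num) hn0.ne']; push_cast; ring_nf
  rw [h4] at h3
  have h5 : n * ∑ m ∈ Ico n (n + n), (1 : ℝ) / m ≤ n * (log 2 + 1 / n - 1 / ((n + n : ℕ) : ℝ)) :=
    mul_le_mul_of_nonneg_left (by linarith) hn0.le
  have h6 : n * (log 2 + 1 / n - 1 / ((n + n : ℕ) : ℝ)) = n * log 2 + 1 / 2 := by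
    push_cast; field_simp; ring
  -- `n ≥ 74` makes `log 2 + 1 / (2 n) ≤ 7 / 10`.
  have h7 : (74 : ℝ) ≤ n := by exact_mod_cast hn
  simp only [sum_const, Nat.card_Ico, add_tsub_cancel_left, nsmul_eq_mul, mul_one]
  nlinarith [log_two_lt_d9]

lemma log_sub_le_sum_vonMangoldt_mul (N : ℕ) (hN : 1 ≤ N) :
    N * (log N - 2 + 3 / 20 * log 2) - 2 * log (N + 1) - (1 + ψ 73)
      ≤ ∑ n ∈ Ico 1 (N + 1), Λ n / n * (N - n) := by
  -- Write `N - n` as a count of the `m ∈ [n, N)` and exchange the sums.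
  have e1 : ∑ n ∈ Ico 1 (N + 1), Λ n / n * ((N : ℝ) - n)
      = ∑ m ∈ Ico 1 N, ∑ n ∈ Ico 1 (m + 1), Λ n / n := by
    rw [Finset.sum_Ico_succ_top hN, sub_self, mul_zero, add_zero,
      ← Finset.sum_Ico_Ico_comm 1 N fun n _ => Λ n / (n : ℝ)]
    refine Finset.sum_congr rfl fun n hn => ?_
    rw [Finset.sum_const, Nat.card_Ico, nsmul_eq_mul, Nat.cast_sub (Finset.mem_Ico.1 hn).2.le,
      mul_comm]
  have e2 : ∀ m ∈ Ico 1 N, ∑ n ∈ Ico 1 (m + 1), Λ n / n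
      = log m.factorial / m + ∑ n ∈ Ico 1 (m + 1), Λ n / n * (((m % n : ℕ) : ℝ) / m) := by
    intro m hm
    have hm0 : (m : ℝ) ≠ 0 := by
      have := (Finset.mem_Ico.1 hm).1
      exact_mod_cast (by omega : m ≠ 0)
    rw [← sum_vonMangoldt_mul_div_eq_log_factorial, Finset.sum_div, ← Finset.sum_add_distrib]
    refine Finset.sum_congr rfl fun n hn => ?_
    have hn0 : (n : ℝ) ≠ 0 := by
      have := (Finset.mem_Ico.1 hn).1
      exact_mod_cast (by omega : n ≠ 0)
    have hdm : (n : ℝ) * ((m / n : ℕ) : ℝ) + ((m % n : ℕ) : ℝ) = m := by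
      exact_mod_cast Nat.div_add_mod m n
    field_simp
    linear_combination (-Λ n) * hdm
  rw [e1, Finset.sum_congr rfl e2, Finset.sum_add_distrib,
    ← Finset.sum_Ico_Ico_comm 1 N fun n m => Λ n / (n : ℝ) * (((m % n : ℕ) : ℝ) / m)]
  have f1 : N * log N - 2 * N - log (N + 1) ≤ ∑ m ∈ Ico 1 N, log m.factorial / m := by
    have g1 : ∑ m ∈ Ico 1 N, (log m - 1) ≤ ∑ m ∈ Ico 1 N, log m.factorial / m := by
      refine Finset.sum_le_sum fun m hm => ?_
      have hm0 : (0 : ℝ) < m := by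
        have := (Finset.mem_Ico.1 hm).1
        exact_mod_cast (by omega : 0 < m)
      rw [le_div_iff₀ hm0]
      linarith [mul_log_sub_le_log_factorial m]
    have g2 : log N.factorial = ∑ m ∈ Ico 1 N, log m + log N := by
      rw [← Finset.sum_Ico_succ_top hN fun m : ℕ => log (m : ℝ),
        ← Finset.prod_Ico_id_eq_factorial, Nat.cast_prod, log_prod]
      intro i hi
      have := (Finset.mem_Ico.1 hi).1
      exact_mod_cast (by omega : i ≠ 0)
    have g3 := mul_log_sub_le_log_factorial N
    have g4 : log N ≤ log (N + 1) :=
      log_le_log (by exact_mod_cast hN) (by linarith)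
    rw [Finset.sum_sub_distrib, Finset.sum_const, Nat.card_Ico, nsmul_eq_mul,
      Nat.cast_sub hN] at g1
    push_cast at g1
    linarith
  have f2 : 3 / 20 * N * log 2 - log (N + 1) - (1 + ψ 73)
      ≤ ∑ n ∈ Ico 1 N, ∑ m ∈ Ico n N, Λ n / (n : ℝ) * (((m % n : ℕ) : ℝ) / m) := by
    have g1 : ∑ n ∈ Ico 74 (N / 2 + 1), 3 / 10 * Λ n
        ≤ ∑ n ∈ Ico 1 N, ∑ m ∈ Ico n N, Λ n / (n : ℝ) * (((m % n : ℕ) : ℝ) / m) := by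
      refine (Finset.sum_le_sum fun n hn => ?_).trans
        (Finset.sum_le_sum_of_subset_of_nonneg (s := Ico 74 (N / 2 + 1)) (fun n hn => ?_)
          fun n _ _ => Finset.sum_nonneg fun m _ => ?_)
      · rw [Finset.mem_Ico] at hn
        rw [← Finset.mul_sum]
        have hn0 : (0 : ℝ) < n := by exact_mod_cast (by omega : 0 < n)
        have := mul_le_mul_of_nonneg_left (mul_le_sum_mod_div (N := N) hn.1 (by omega))
          (div_nonneg (vonMangoldt_nonneg (n := n)) hn0.le)
        refine le_trans (le_of_eq ?_) this
        field_simp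
      · rw [Finset.mem_Ico] at hn ⊢; omega
      · exact mul_nonneg (div_nonneg vonMangoldt_nonneg (Nat.cast_nonneg _)) (by positivity)
    rw [← Finset.mul_sum] at g1
    have g2 : ψ ((N / 2 : ℕ) : ℝ) ≤ ψ 73 + ∑ n ∈ Ico 74 (N / 2 + 1), Λ n := by
      have e3 : ∀ m : ℕ, ψ (m : ℝ) = ∑ n ∈ Ico 1 (m + 1), Λ n := fun m => by
        rw [psi, Nat.floor_natCast]; congr 1
      have := e3 73
      push_cast at this
      rw [e3, this]
      rcases le_total 73 (N / 2) with h | h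
      · rw [Finset.sum_Ico_consecutive _ (by omega) (by omega)]
      · refine (Finset.sum_le_sum_of_subset_of_nonneg
          (Finset.Ico_subset_Ico_right (by omega)) fun _ _ _ => vonMangoldt_nonneg).trans
          (le_add_of_nonneg_right (Finset.sum_nonneg fun _ _ => vonMangoldt_nonneg))
    have g3 := psi_ge (N / 2)
    have g4 : ((N : ℝ) - 1) / 2 ≤ ((N / 2 : ℕ) : ℝ) := by
      have : N ≤ 2 * (N / 2) + 1 := by omega
      have : (N : ℝ) ≤ 2 * ((N / 2 : ℕ) : ℝ) + 1 := by exact_mod_cast this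
      linarith
    have g5 : log (((N / 2 : ℕ) : ℝ) + 1) ≤ log (N + 1) := by
      refine log_le_log (by positivity) ?_
      have : N / 2 ≤ N := Nat.div_le_self _ _
      have : ((N / 2 : ℕ) : ℝ) ≤ N := by exact_mod_cast this
      linarith
    have g6 : 0 ≤ log ((N : ℝ) + 1) := log_nonneg (by linarith [(Nat.cast_nonneg N : (0:ℝ) ≤ N)])
    have g7 := mul_le_mul_of_nonneg_right g4 (log_pos one_lt_two).le
    have g8 := psi_nonneg 73
    linarith [log_two_lt_d9]
  have := add_le_add f1 f2
  refine le_trans (le_of_eq ?_) this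
  ring

lemma eventually_log_sub_le_sum_vonMangoldt {δ : ℝ} (hδ : 0 < δ) : ∀ᶠ N : ℕ in atTop,
    log N - 2 + 3 / 20 * log 2 - δ ≤ ∑ n ∈ Ico 1 (N + 1), Λ n / n * (1 - n / N) := by
  have h1 : Tendsto (fun N : ℕ => (2 * log (N + 1) + (1 + ψ 73)) / N) atTop (nhds 0) := by
    have hlog : Tendsto (fun x : ℝ => (2 * log x + (1 + ψ 73)) / (x - 1)) atTop (nhds 0) := by
      have a1 : (fun x : ℝ => 2 * log x + (1 + ψ 73)) =o[atTop] fun x : ℝ => x :=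
        (isLittleO_log_id_atTop.const_mul_left 2).add
          (Asymptotics.isLittleO_const_id_atTop _)
      have a2 : (fun x : ℝ => x) =O[atTop] fun x : ℝ => x - 1 := by
        refine Asymptotics.IsBigO.of_bound 2 ?_
        filter_upwards [eventually_ge_atTop 2] with x hx
        rw [norm_of_nonneg (by linarith), norm_of_nonneg (by linarith)]
        linarith
      exact (a1.trans_isBigO a2).tendsto_div_nhds_zero
    have := hlog.comp (tendsto_atTop_add_const_right atTop 1 tendsto_natCast_atTop_atTop)
    refine this.congr fun N => ?_
    simp
  filter_upwards [h1.eventually (gt_mem_nhds hδ), eventually_ge_atTop 1] with N hN hN1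
  have hN0 : (0 : ℝ) < N := by exact_mod_cast hN1
  rw [div_lt_iff₀ hN0] at hN
  have h2 := log_sub_le_sum_vonMangoldt_mul N hN1
  have h3 : ∑ n ∈ Ico 1 (N + 1), Λ n / n * (1 - (n : ℝ) / N)
      = (∑ n ∈ Ico 1 (N + 1), Λ n / n * ((N : ℝ) - n)) / N := by
    rw [Finset.sum_div]
    refine Finset.sum_congr rfl fun n _ => ?_
    rw [mul_div_assoc, sub_div, div_self hN0.ne']
  rw [h3, le_div_iff₀ hN0]
  linarith

/-- Abel summation: a weight that decreases gives a nonpositive sum against a sequence with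
nonpositive partial sums. -/
lemma sum_mul_nonpos_of_antitone {b h : ℕ → ℝ} {N : ℕ}
    (hb : ∀ m ≤ N, ∑ n ∈ range m, b n ≤ 0)
    (hh : ∀ n, n + 1 < N → h (n + 1) ≤ h n) (h0 : ∀ n < N, 0 ≤ h n) :
    ∑ n ∈ range N, b n * h n ≤ 0 := by
  have key : ∀ m < N, ∑ n ∈ range (m + 1), b n * h n ≤ (∑ n ∈ range (m + 1), b n) * h m := by
    intro m
    induction m with
    | zero => intro _; simp
    | succ m ih =>
      intro hm
      rw [Finset.sum_range_succ, Finset.sum_range_succ b (m + 1), add_mul]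
      have h1 := mul_le_mul_of_nonpos_left (hh m hm) (hb (m + 1) hm.le)
      linarith [ih (by omega)]
  rcases Nat.eq_zero_or_pos N with rfl | hN
  · simp
  obtain ⟨m, rfl⟩ : ∃ m, N = m + 1 := ⟨N - 1, by omega⟩
  exact (key m (by omega)).trans (mul_nonpos_of_nonpos_of_nonneg (hb _ le_rfl) (h0 m (by omega)))

lemma sum_log_two_mul_sub_div_le (N : ℕ) :
    ∑ i ∈ range N, log ((2 * N - (i + 1 : ℕ)) / (i + 1 : ℕ)) ≤ N * log 4 := by
  rcases Nat.eq_zero_or_pos N with rfl | hN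
  · simp
  have h1 : ∀ i ∈ range N, log ((2 * N - (i + 1 : ℕ)) / (i + 1 : ℕ))
      = log ((2 * N - 1 - i : ℕ) : ℝ) - log ((i + 1 : ℕ) : ℝ) := by
    intro i hi
    have hi' := Finset.mem_range.1 hi
    have e : (2 * N - (i + 1 : ℕ) : ℝ) = ((2 * N - 1 - i : ℕ) : ℝ) := by
      rw [Nat.sub_sub, add_comm 1 i, Nat.cast_sub (by omega)]; push_cast; ring
    rw [e, log_div]
    · exact_mod_cast (by omega : 2 * N - 1 - i ≠ 0)
    · positivity
  rw [Finset.sum_congr rfl h1, Finset.sum_sub_distrib, ← log_prod, ← log_prod]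
  · rw [← Nat.cast_prod, ← Nat.cast_prod, ← Nat.descFactorial_eq_prod_range,
      Finset.prod_range_add_one_eq_factorial, Nat.descFactorial_eq_factorial_mul_choose,
      Nat.cast_mul, log_mul (by positivity)
        (by exact_mod_cast (Nat.choose_pos (by omega : N ≤ 2 * N - 1)).ne'),
      add_sub_cancel_left, ← log_pow]
    refine log_le_log (by exact_mod_cast Nat.choose_pos (by omega : N ≤ 2 * N - 1)) ?_
    have h2 : (2 * N - 1).choose N ≤ 4 ^ N := by
      calc (2 * N - 1).choose N ≤ 2 ^ (2 * N - 1) := Nat.choose_le_two_pow _ _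
        _ ≤ 2 ^ (2 * N) := Nat.pow_le_pow_right (by norm_num) (by omega)
        _ = 4 ^ N := by rw [pow_mul]; norm_num
    exact_mod_cast h2
  · intro i _; positivity
  · intro i hi
    have hi' := Finset.mem_range.1 hi
    exact_mod_cast (by omega : 2 * N - 1 - i ≠ 0)

end PrimeSums

/-! ### The size of the resonator -/

section PrimeSums

open Real Filter Finset Chebyshev
open ArithmeticFunction hiding log id

/-- The primes up to `N`. -/
def primesTo (N : ℕ) : Finset ℕ := (Ico 1 (N + 1)).filter Nat.Prime

lemma mem_primesTo {N p : ℕ} : p ∈ primesTo N ↔ p.Prime ∧ p ≤ N := by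
  simp only [primesTo, Finset.mem_filter, Finset.mem_Ico]
  exact ⟨fun h => ⟨h.2, by omega⟩, fun h => ⟨⟨h.1.one_lt.le, by omega⟩, h.1⟩⟩

lemma sum_primesTo_log_mul_le (N : ℕ) :
    ∑ p ∈ primesTo N, log p * log ((2 * N - p) / p) ≤ (log 4) ^ 2 * N := by
  set h : ℕ → ℝ := fun i => log ((2 * N - (i + 1 : ℕ)) / (i + 1 : ℕ)) with hh
  set a : ℕ → ℝ := fun i => if (i + 1).Prime then log ((i + 1 : ℕ) : ℝ) else 0 with ha
  have hval : ∀ i < N, (i + 1 : ℕ) ≤ (N : ℝ) := fun i hi => by exact_mod_cast hi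
  have e1 : ∑ p ∈ primesTo N, log p * log ((2 * N - p) / p) = ∑ i ∈ range N, a i * h i := by
    rw [primesTo, Finset.sum_filter, Finset.sum_Ico_eq_sum_range, Nat.add_sub_cancel]
    refine Finset.sum_congr rfl fun i _ => ?_
    simp only [ha, hh, add_comm 1 i]
    split_ifs <;> simp
  have e2 : ∀ m : ℕ, ∑ i ∈ range m, a i = θ m := by
    intro m
    have : Ioc 0 m = Ico 1 (m + 1) := by ext; simp; omega
    rw [theta, Nat.floor_natCast, Finset.sum_filter, this, Finset.sum_Ico_eq_sum_range,
      Nat.add_sub_cancel]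
    refine Finset.sum_congr rfl fun i _ => ?_
    simp only [ha, add_comm 1 i]
  have key := sum_mul_nonpos_of_antitone (b := fun i => a i - log 4) (h := h) (N := N)
    (fun m _ => by
      rw [Finset.sum_sub_distrib, e2, sum_const, card_range, nsmul_eq_mul]
      linarith [theta_le_log4_mul_x (Nat.cast_nonneg m : (0 : ℝ) ≤ m)])
    (fun n hn => by
      have h1 := hval n (by omega)
      have h2 := hval (n + 1) hn
      push_cast at h1 h2
      refine log_le_log (div_pos (by push_cast; linarith) (by positivity)) ?_
      rw [div_le_div_iff₀ (by positivity) (by positivity)]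
      push_cast
      nlinarith)
    (fun n hn => by
      have h1 := hval n hn
      refine log_nonneg ?_
      rw [one_le_div (by positivity)]
      linarith)
  simp only [sub_mul] at key
  rw [Finset.sum_sub_distrib, ← Finset.mul_sum] at key
  rw [e1]
  have h3 := mul_le_mul_of_nonneg_left (sum_log_two_mul_sub_div_le N)
    (log_pos (by norm_num : (1 : ℝ) < 4)).le
  nlinarith

/-- The ratio of the maximum of the resonator to its mean has logarithm at most
`(log 4)² N / log N` asymptotically. One factor `log 4` is `∫₀¹ log ((2 - u) / u) du`, the other
is the constant in Chebyshev's bound `θ(x) ≤ x log 4`. -/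
lemma eventually_sum_primesTo_log_le {κ : ℝ} (hκ : (log 4) ^ 2 < κ) : ∀ᶠ N : ℕ in atTop,
    ∑ p ∈ primesTo N, log ((2 * N - p) / p) ≤ κ * (N / log N) := by
  have hl4 : 0 < (log 4) ^ 2 := pow_pos (log_pos (by norm_num)) 2
  obtain ⟨κ', h1, h2⟩ := exists_between hκ
  have hκ' : 0 < κ' := hl4.trans h1
  -- Primes below `N ^ r` are negligible, and for the others `log p ≥ r log N`.
  set r := (log 4) ^ 2 / κ' with hr
  have hr0 : 0 < r := div_pos hl4 hκ'
  have hr1 : r < 1 := (div_lt_one hκ').2 h1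
  have hsmall : ∀ᶠ N : ℕ in atTop, 2 * (log N) ^ (2 : ℝ) ≤ (κ - κ') * (N : ℝ) ^ (1 - r) := by
    have := ((isLittleO_log_rpow_rpow_atTop 2 (sub_pos.2 hr1)).const_mul_left 2).bound
      (sub_pos.2 h2)
    filter_upwards [tendsto_natCast_atTop_atTop.eventually this, eventually_ge_atTop 1] with N hN h1
    have : 0 ≤ log (N : ℝ) := log_natCast_nonneg N
    rwa [norm_of_nonneg (by positivity), norm_of_nonneg (by positivity)] at hN
  filter_upwards [hsmall, eventually_ge_atTop 2] with N hN hN2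
  have hN0 : (0 : ℝ) < N := by exact_mod_cast (by omega : 0 < N)
  have hN2' : (2 : ℝ) ≤ N := by exact_mod_cast hN2
  have hL : 0 < log (N : ℝ) := log_pos (by linarith)
  have hterm : ∀ p ∈ primesTo N, log ((2 * N - p) / p)
      ≤ (log p * log ((2 * N - p) / p)) / (r * log N)
        + if (p : ℝ) ≤ (N : ℝ) ^ r then 2 * log N else 0 := by
    intro p hp
    rw [mem_primesTo] at hp
    have hp0 : (1 : ℝ) ≤ p := by exact_mod_cast hp.1.one_lt.le
    have hpN : (p : ℝ) ≤ N := by exact_mod_cast hp.2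
    have hh : 0 ≤ log ((2 * N - p) / p) := by
      refine log_nonneg ?_
      rw [one_le_div (by linarith)]
      linarith
    have hlp : 0 ≤ log (p : ℝ) := log_nonneg hp0
    split_ifs with hif
    · have : log ((2 * N - p) / p) ≤ 2 * log N := by
        rw [← log_rpow hN0]
        refine log_le_log (div_pos (by linarith) (by linarith)) ?_
        rw [rpow_two, div_le_iff₀ (by linarith)]
        nlinarith [mul_le_mul_of_nonneg_left hp0 (sq_nonneg (N : ℝ))]
      have : 0 ≤ (log p * log ((2 * N - p) / p)) / (r * log N) := by positivity
      linarith
    · rw [add_zero, le_div_iff₀ (by positivity), mul_comm]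
      refine mul_le_mul_of_nonneg_right ?_ hh
      rw [← log_rpow hN0]
      exact log_le_log (by positivity) (not_le.1 hif).le
  refine (Finset.sum_le_sum hterm).trans ?_
  rw [Finset.sum_add_distrib, ← Finset.sum_div, ← Finset.sum_filter, sum_const, nsmul_eq_mul]
  have hcard : ((#{p ∈ primesTo N | ((p : ℕ) : ℝ) ≤ (N : ℝ) ^ r} : ℕ) : ℝ) ≤ (N : ℝ) ^ r := by
    have : #{p ∈ primesTo N | ((p : ℕ) : ℝ) ≤ (N : ℝ) ^ r} ≤ #(Ioc 0 ⌊(N : ℝ) ^ r⌋₊) := by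
      refine Finset.card_le_card fun p hp => ?_
      rw [Finset.mem_filter, mem_primesTo] at hp
      exact Finset.mem_Ioc.2 ⟨hp.1.1.pos, Nat.le_floor hp.2⟩
    rw [Nat.card_Ioc, Nat.sub_zero] at this
    exact (Nat.cast_le.2 this).trans (Nat.floor_le (by positivity))
  have hmain : (∑ p ∈ primesTo N, log p * log ((2 * N - p) / p)) / (r * log N)
      ≤ κ' * (N / log N) := by
    rw [div_le_iff₀ (by positivity)]
    refine (sum_primesTo_log_mul_le N).trans (le_of_eq ?_)
    rw [hr]; field_simp
  have hrest : (N : ℝ) ^ r * (2 * log N) ≤ (κ - κ') * (N / log N) := by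
    rw [← mul_div_assoc, le_div_iff₀ hL]
    have := mul_le_mul_of_nonneg_left hN (rpow_nonneg hN0.le r)
    rw [rpow_two] at this
    have e : (N : ℝ) ^ r * ((κ - κ') * (N : ℝ) ^ (1 - r)) = (κ - κ') * N := by
      rw [mul_left_comm, ← rpow_add hN0]; simp
    linarith
  have h5 := mul_le_mul_of_nonneg_right hcard (by positivity : 0 ≤ 2 * log (N : ℝ))
  linarith

end PrimeSums

/-! ### Numerical constants -/

section Constants

open Real

lemma summable_log_div_prime_sq :
    Summable fun p : Nat.Primes => log ((p : ℕ) : ℝ) / ((p : ℕ) : ℝ) ^ 2 := by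
  have h : Summable fun n : ℕ => 2 * (1 / (n : ℝ) ^ (3 / 2 : ℝ)) :=
    (summable_one_div_nat_rpow.2 (by norm_num)).mul_left 2
  have h2 : Summable fun n : ℕ => log (n : ℝ) / (n : ℝ) ^ 2 := by
    refine Summable.of_nonneg_of_le
      (fun n => div_nonneg (log_natCast_nonneg n) (by positivity)) (fun n => ?_) h
    rcases Nat.eq_zero_or_pos n with rfl | hn
    · simp
    have hn' : (0 : ℝ) < n := by exact_mod_cast hn
    have h3 := log_le_rpow_div hn'.le (by norm_num : (0 : ℝ) < 1 / 2)
    rw [mul_one_div, div_le_div_iff₀ (by positivity) (by positivity)]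
    have h4 : (n : ℝ) ^ (1 / 2 : ℝ) * (n : ℝ) ^ (3 / 2 : ℝ) = (n : ℝ) ^ 2 := by
      rw [← rpow_add hn', ← rpow_two]; norm_num
    calc log n * (n : ℝ) ^ (3 / 2 : ℝ)
        ≤ ((n : ℝ) ^ (1 / 2 : ℝ) / (1 / 2)) * (n : ℝ) ^ (3 / 2 : ℝ) := by gcongr
      _ = 2 * ((n : ℝ) ^ (1 / 2 : ℝ) * (n : ℝ) ^ (3 / 2 : ℝ)) := by ring
      _ = 2 * (n : ℝ) ^ 2 := by rw [h4]
  exact h2.comp_injective Subtype.coe_injective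

lemma log_div_pow_add_two_le (p : Nat.Primes) (k : ℕ) :
    log ((p : ℕ) : ℝ) / ((p : ℕ) : ℝ) ^ (k + 2)
      ≤ (1 / 2) ^ k * (log ((p : ℕ) : ℝ) / ((p : ℕ) : ℝ) ^ 2) := by
  have hp : (2 : ℝ) ≤ ((p : ℕ) : ℝ) := by exact_mod_cast p.prop.two_le
  have hl : 0 ≤ log ((p : ℕ) : ℝ) := log_natCast_nonneg _
  rw [pow_add, ← div_div, div_right_comm, mul_comm, one_div, inv_pow, ← div_eq_mul_inv]
  gcongr

lemma summable_log_div_prime_pow (k : ℕ) :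
    Summable fun p : Nat.Primes => log ((p : ℕ) : ℝ) / ((p : ℕ) : ℝ) ^ (k + 2) :=
  Summable.of_nonneg_of_le (fun _ => div_nonneg (log_natCast_nonneg _) (by positivity))
    (fun p => log_div_pow_add_two_le p k) (summable_log_div_prime_sq.mul_left _)

lemma summable_tsum_log_div_prime_pow :
    Summable fun k : ℕ => ∑' p : Nat.Primes, log ((p : ℕ) : ℝ) / ((p : ℕ) : ℝ) ^ (k + 2) := by
  refine Summable.of_nonneg_of_le
    (fun k => tsum_nonneg fun _ => div_nonneg (log_natCast_nonneg _) (by positivity))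
    (fun k => ?_) ((summable_geometric_of_lt_one (by norm_num : (0 : ℝ) ≤ 1 / 2)
      (by norm_num)).mul_right
      (∑' p : Nat.Primes, log ((p : ℕ) : ℝ) / ((p : ℕ) : ℝ) ^ 2))
  rw [← tsum_mul_left]
  exact (summable_log_div_prime_pow k).tsum_le_tsum (fun p => log_div_pow_add_two_le p k)
    (summable_log_div_prime_sq.mul_left _)

lemma hasSum_log_div_pow {p : ℕ} (hp : 2 ≤ p) :
    HasSum (fun k : ℕ => log (p : ℝ) / (p : ℝ) ^ (k + 2)) (log p / (p * (p - 1))) := by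
  have hp' : (2 : ℝ) ≤ p := by exact_mod_cast hp
  have hp0 : (p : ℝ) ≠ 0 := by linarith
  have hp1 : (p : ℝ) - 1 ≠ 0 := by linarith
  have h := (hasSum_geometric_of_lt_one (r := (p : ℝ)⁻¹) (by positivity)
    (inv_lt_one_of_one_lt₀ (by linarith))).mul_left (log (p : ℝ) / (p : ℝ) ^ 2)
  have e1 : log (p : ℝ) / (p : ℝ) ^ 2 * (1 - (p : ℝ)⁻¹)⁻¹ = log p / (p * (p - 1)) := by
    rw [show 1 - (p : ℝ)⁻¹ = ((p : ℝ) - 1) / p by field_simp, inv_div]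
    field_simp
  rw [e1] at h
  have e2 : (fun k : ℕ => log (p : ℝ) / (p : ℝ) ^ (k + 2))
      = fun k => log (p : ℝ) / (p : ℝ) ^ 2 * (p : ℝ)⁻¹ ^ k := by
    ext k
    rw [pow_add, inv_pow, ← div_eq_mul_inv, div_div, mul_comm]
  rwa [e2]

lemma sum_log_div_mul_le_primePowerLogSum (s : Finset ℕ) (hs : ∀ p ∈ s, p.Prime) :
    ∑ p ∈ s, log (p : ℝ) / (p * (p - 1)) ≤ primePowerLogSum := by
  refine hasSum_le (fun k => ?_) (hasSum_sum fun p hp => hasSum_log_div_pow (hs p hp).two_le)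
    summable_tsum_log_div_prime_pow.hasSum
  rw [← Finset.sum_subtype_of_mem (fun p : ℕ => log (p : ℝ) / (p : ℝ) ^ (k + 2)) hs]
  let S : Finset Nat.Primes := s.subtype Nat.Prime
  have h := (summable_log_div_prime_pow k).sum_le_tsum S
    fun _ _ => div_nonneg (log_natCast_nonneg _) (by positivity)
  exact h

lemma div_mul_log_two_le_log {a b p : ℕ} (ha : 0 < a) (h : 2 ^ b ≤ p ^ a) :
    (b / a : ℝ) * log 2 ≤ log p := by
  have ha' : (0 : ℝ) < a := by exact_mod_cast ha
  have h1 : log ((2 : ℝ) ^ b) ≤ log ((p : ℝ) ^ a) :=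
    log_le_log (by positivity) (by exact_mod_cast h)
  rw [log_pow, log_pow] at h1
  rw [div_mul_eq_mul_div, div_le_iff₀ ha']
  linarith

/-- The numerical inequality behind the theorem: the contribution of the prime powers outweighs
the losses in the elementary estimates that replace the prime number theorem. -/
lemma log_log_four_add_one_sub_le :
    log (log 4) + 1 - 3 / 20 * log 2 ≤ eulerMascheroniConstant + primePowerLogSum := by
  have hγ : (5614 : ℝ) / 10000 ≤ eulerMascheroniConstant := by
    have h := (eulerMascheroniSeq_lt_eulerMascheroniConstant 31).le
    have h32 : log ((31 : ℕ) + 1 : ℝ) = 5 * log 2 := by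
      rw [show ((31 : ℕ) + 1 : ℝ) = 2 ^ 5 by norm_num, log_pow]; norm_num
    rw [eulerMascheroniSeq, h32] at h
    have hH : (40272 : ℝ) / 10000 ≤ ((harmonic 31 : ℚ) : ℝ) := by
      have : (40272 : ℚ) / 10000 ≤ harmonic 31 := by
        simp only [harmonic, Finset.sum_range_succ, Finset.sum_range_zero]
        norm_num
      have h2 : (((40272 : ℚ) / 10000 : ℚ) : ℝ) ≤ ((harmonic 31 : ℚ) : ℝ) := by exact_mod_cast this
      push_cast at h2
      exact h2
    linarith [log_two_lt_d9]
  have hS : (6775 : ℝ) / 10000 ≤ primePowerLogSum := by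
    have h := sum_log_div_mul_le_primePowerLogSum {2, 3, 5, 7, 11} (by norm_num)
    -- Each ratio `b / a` is a good lower approximation to `log p / log 2`.
    have h3 := div_mul_log_two_le_log (a := 12) (b := 19) (p := 3) (by norm_num) (by norm_num)
    have h5 := div_mul_log_two_le_log (a := 28) (b := 65) (p := 5) (by norm_num) (by norm_num)
    have h7 := div_mul_log_two_le_log (a := 5) (b := 14) (p := 7) (by norm_num) (by norm_num)
    have h11 := div_mul_log_two_le_log (a := 11) (b := 38) (p := 11) (by norm_num) (by norm_num)
    rw [Finset.sum_insert (by decide), Finset.sum_insert (by decide),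
      Finset.sum_insert (by decide), Finset.sum_insert (by decide), Finset.sum_singleton] at h
    norm_num at h h3 h5 h7 h11
    linarith [log_two_gt_d9]
  have hlog : log (log 4) ≤ 327 / 1000 := by
    have h4 : log 4 = 2 * log 2 := by
      rw [show (4 : ℝ) = 2 ^ 2 by norm_num, log_pow]; norm_num
    rw [log_le_iff_le_exp (log_pos (by norm_num)), h4]
    have := sum_le_exp_of_nonneg (x := 327 / 1000) (by norm_num) 5
    simp only [Finset.sum_range_succ, Finset.sum_range_zero, Nat.factorial] at this
    norm_num at this
    linarith [log_two_lt_d9]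
  linarith [log_two_gt_d9]

end Constants

/-! ### The length of the resonator -/

section PrimeSums

open Real Filter Finset
open ArithmeticFunction hiding log id

/-- The number of primes in the resonator: for `N` a constant multiple of `log T log log T` the
resonator exceeds its mean by at most a factor `T ^ ρ` with `ρ < 1 - β`, while the smoothed sum of
`Λ(n) / n` up to `N` reaches the bound claimed for the logarithmic derivative. -/
lemma exists_resonator_length {β ε : ℝ} (hβ : β < 1) (hε : 0 < ε) :
    ∃ ρ < 1 - β, ∀ᶠ T : ℝ in atTop, ∃ N : ℕ, 0 < N ∧
      ∑ p ∈ primesTo N, log ((2 * N - p) / p) ≤ ρ * log T ∧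
      log (log T) + log (log (log T)) + zetaConst β - ε
        ≤ ∑ n ∈ Ico 1 (N + 1), Λ n / n * (1 - n / N) := by
  have hβ' : 0 < 1 - β := sub_pos.2 hβ
  have hl4 : 0 < log 4 := log_pos (by norm_num)
  set η := ε / 3 with hη
  have hη0 : 0 < η := by positivity
  set c := (1 - β) * exp (-η) / (log 4) ^ 2 with hc
  have hc0 : 0 < c := by positivity
  have hlogc : log c = log (1 - β) - η - 2 * log (log 4) := by
    rw [hc, log_div (by positivity) (by positivity), log_mul (by positivity) (by positivity),
      log_exp, log_pow]
    push_cast; ring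
  set κ := (log 4) ^ 2 * exp (η / 2) with hκ
  have hκ1 : (log 4) ^ 2 < κ := by
    have : 1 < exp (η / 2) := one_lt_exp_iff.2 (by positivity)
    rw [hκ]; nlinarith [pow_pos hl4 2]
  have hκc : κ * c = (1 - β) * exp (-(η / 2)) := by
    have : exp (-(η / 2)) = exp (η / 2) * exp (-η) := by rw [← exp_add]; ring_nf
    rw [this, hκ, hc]; field_simp
  refine ⟨(1 - β) * exp (-(η / 2)), ?_, ?_⟩
  · have : exp (-(η / 2)) < 1 := exp_lt_one_iff.2 (by linarith)
    nlinarith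
  set f : ℝ → ℝ := fun T => c * log T * log (log T) with hf
  have hL : Tendsto (fun T : ℝ => log T) atTop atTop := tendsto_log_atTop
  have hLL : Tendsto (fun T : ℝ => log (log T)) atTop atTop := tendsto_log_atTop.comp hL
  have hftop : Tendsto f atTop atTop := (hL.const_mul_atTop hc0).atTop_mul_atTop₀ hLL
  have hfloor : Tendsto (fun T => ⌊f T⌋₊) atTop atTop := tendsto_nat_floor_atTop.comp hftop
  have hratio : ∀ᶠ T in atTop, exp (-η) * f T ≤ f T - 1 := by
    have h1 : exp (-η) < 1 := exp_lt_one_iff.2 (by linarith)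
    filter_upwards [hftop.eventually_ge_atTop (1 / (1 - exp (-η)))] with T hT
    rw [div_le_iff₀ (by linarith)] at hT
    linarith
  filter_upwards [hfloor.eventually (eventually_sum_primesTo_log_le hκ1),
    hfloor.eventually (eventually_log_sub_le_sum_vonMangoldt hη0),
    hratio, hftop.eventually_ge_atTop 2, hL.eventually_gt_atTop 1,
    hLL.eventually_gt_atTop 0,
    hLL.eventually_ge_atTop (exp η / c)]
    with T h1 h2 h3 h4 h5 h7 h8
  set N := ⌊f T⌋₊ with hN
  have hNle : (N : ℝ) ≤ f T := Nat.floor_le (by linarith)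
  have hNge : exp (-η) * f T ≤ N := h3.trans (Nat.sub_one_lt_floor _).le
  have hN0 : 0 < N := Nat.floor_pos.2 (by linarith)
  have hN0' : (0 : ℝ) < N := by exact_mod_cast hN0
  have hL0 : 0 < log T := by linarith
  have hfpos : 0 < f T := by linarith
  have hlogN : log c + log (log T) + log (log (log T)) - η ≤ log N := by
    have := log_le_log (by positivity) hNge
    rw [log_mul (exp_pos _).ne' hfpos.ne', log_exp, hf] at this
    rw [log_mul (by positivity) h7.ne', log_mul hc0.ne' hL0.ne'] at this
    linarith
  refine ⟨N, hN0, ?_, ?_⟩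
  · refine h1.trans ?_
    have hNL : log T ≤ N := by
      refine le_trans ?_ hNge
      rw [div_le_iff₀ hc0] at h8
      have e : exp (-η) * f T = exp (-η) * (log (log T) * c) * log T := by
        simp only [hf]; ring
      have : 1 ≤ exp (-η) * (log (log T) * c) := by
        calc (1 : ℝ) = exp (-η) * exp η := by rw [← exp_add]; simp
          _ ≤ _ := by gcongr
      rw [e]; nlinarith
    have hlogNL : log (log T) ≤ log N := log_le_log hL0 hNL
    have : (N : ℝ) / log N ≤ c * log T := by
      rw [div_le_iff₀ (by linarith)]
      refine hNle.trans ?_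
      simp only [hf]
      gcongr
    calc κ * (N / log N) ≤ κ * (c * log T) := by gcongr
      _ = (1 - β) * exp (-(η / 2)) * log T := by rw [← mul_assoc, hκc]
  · refine le_trans ?_ h2
    have := log_log_four_add_one_sub_le
    rw [zetaConst]
    rw [hlogc] at hlogN
    linarith

end PrimeSums

/-! ### The logarithmic derivative of zeta -/

section ZetaLogDeriv

open Real Filter Topology
open ArithmeticFunction hiding log id

/-- The function `-Re (ζ'/ζ) (σ + i t)`. -/
noncomputable def negReLogDeriv (σ t : ℝ) : ℝ :=
  -(deriv riemannZeta (σ + Complex.I * t) / riemannZeta (σ + Complex.I * t)).re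

lemma continuousAt_negReLogDeriv {σ t : ℝ} (hσ : 1 ≤ σ) (h : σ ≠ 1 ∨ t ≠ 0) :
    ContinuousAt (fun x : ℝ × ℝ => negReLogDeriv x.1 x.2) (σ, t) := by
  have hs : (σ + Complex.I * t : ℂ) ≠ 1 := by
    intro hs
    have h1 := congrArg Complex.re hs
    have h2 := congrArg Complex.im hs
    simp at h1 h2
    exact h.elim (fun h => h h1) fun h => h h2
  have h0 : riemannZeta (σ + Complex.I * t) ≠ 0 :=
    riemannZeta_ne_zero_of_one_le_re (by simpa using hσ)
  have ha := analyticOn_riemannZeta _ hs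
  have hc : ContinuousAt (fun s : ℂ => deriv riemannZeta s / riemannZeta s)
      (σ + Complex.I * t) := ha.deriv.continuousAt.div ha.continuousAt h0
  have hg : ContinuousAt (fun x : ℝ × ℝ => (x.1 + Complex.I * x.2 : ℂ)) (σ, t) := by fun_prop
  exact (Complex.continuous_re.continuousAt.comp
    (ContinuousAt.comp (f := fun x : ℝ × ℝ => (x.1 + Complex.I * x.2 : ℂ)) hc hg)).neg

lemma continuous_negReLogDeriv {σ : ℝ} (hσ : 1 < σ) : Continuous (negReLogDeriv σ) := by
  refine continuous_iff_continuousAt.2 fun t => ?_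
  exact ContinuousAt.comp (f := fun t : ℝ => (σ, t)) (g := fun x : ℝ × ℝ => negReLogDeriv x.1 x.2)
    (continuousAt_negReLogDeriv hσ.le (Or.inl hσ.ne')) (by fun_prop)

lemma summable_vonMangoldt_mul_rpow {σ : ℝ} (hσ : 1 < σ) :
    Summable fun n : ℕ => Λ n * (n : ℝ) ^ (-σ) := by
  have h := (LSeriesSummable_vonMangoldt (s := (σ : ℂ)) (by simpa using hσ)).norm
  refine h.congr fun n => ?_
  rcases Nat.eq_zero_or_pos n with rfl | hn
  · simp
  have hn' : (0 : ℝ) < n := by exact_mod_cast hn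
  rw [LSeries.norm_term_eq, if_neg hn.ne', Complex.norm_real, norm_of_nonneg vonMangoldt_nonneg,
    Complex.ofReal_re, rpow_neg hn'.le, div_eq_mul_inv]

lemma hasSum_negReLogDeriv {σ : ℝ} (hσ : 1 < σ) (t : ℝ) :
    HasSum (fun n : ℕ => Λ n * (n : ℝ) ^ (-σ) * cos (log n * t)) (negReLogDeriv σ t) := by
  have hs : 1 < (σ + Complex.I * t : ℂ).re := by simpa using hσ
  have h := Complex.hasSum_re (LSeriesSummable_vonMangoldt hs).LSeriesHasSum
  rw [LSeries_vonMangoldt_eq_deriv_riemannZeta_div hs, neg_div, Complex.neg_re] at h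
  refine h.congr_fun fun n => ?_
  rcases Nat.eq_zero_or_pos n with rfl | hn
  · simp
  have hn' : (0 : ℝ) < n := by exact_mod_cast hn
  have hpow : ((n : ℂ) ^ (-(σ + Complex.I * t : ℂ))).re = (n : ℝ) ^ (-σ) * cos (log n * t) := by
    rw [Complex.cpow_def_of_ne_zero (by exact_mod_cast hn.ne'), ← Complex.natCast_log,
      Complex.exp_re, rpow_def_of_pos hn']
    generalize log (n : ℝ) = x
    simp
  rw [LSeries.term_of_ne_zero hn.ne', div_eq_mul_inv, ← Complex.cpow_neg, Complex.re_ofReal_mul,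
    hpow, mul_assoc]

lemma hasSum_integral_negReLogDeriv_mul {σ T : ℝ} (hσ : 1 < σ) {W : ℝ → ℝ} (hW : Continuous W) :
    HasSum (fun n : ℕ => Λ n * (n : ℝ) ^ (-σ) * cosTransform T W (log n))
      (∫ t in (0 : ℝ)..T, negReLogDeriv σ t * W t) := by
  have hs := summable_vonMangoldt_mul_rpow hσ
  have h0 : ∀ n : ℕ, 0 ≤ Λ n * (n : ℝ) ^ (-σ) := fun n =>
    mul_nonneg vonMangoldt_nonneg (by positivity)
  have h := intervalIntegral.hasSum_integral_of_dominated_convergence (a := 0) (b := T)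
    (μ := MeasureTheory.volume)
    (F := fun (n : ℕ) t => Λ n * (n : ℝ) ^ (-σ) * cos (log n * t) * W t)
    (f := fun t => negReLogDeriv σ t * W t)
    (fun n t => Λ n * (n : ℝ) ^ (-σ) * |W t|)
    (fun n => Continuous.aestronglyMeasurable (by fun_prop))
    (fun n => Eventually.of_forall fun t _ => by
      rw [norm_eq_abs, abs_mul, abs_mul, abs_of_nonneg (h0 n)]
      exact mul_le_mul_of_nonneg_right (mul_le_of_le_one_right (h0 n) (abs_cos_le_one _))
        (abs_nonneg _))
    (Eventually.of_forall fun t _ => hs.mul_right _)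
    (by
      simp_rw [tsum_mul_right]
      exact Continuous.intervalIntegrable (by fun_prop) _ _)
    (Eventually.of_forall fun t _ => (hasSum_negReLogDeriv hσ t).mul_right _)
  refine h.congr_fun fun n => ?_
  rw [cosTransform, ← intervalIntegral.integral_const_mul]
  refine intervalIntegral.integral_congr fun t _ => ?_
  ring

lemma cosTransform_triWeight_mul_cos {V T l m : ℝ} :
    cosTransform T (fun t => triWeight V t * cos (l * t)) m
      = (cosTransform T (triWeight V) (m - l) + cosTransform T (triWeight V) (m + l)) / 2 := by
  have hc := continuous_triWeight V
  simp only [cosTransform]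
  rw [← intervalIntegral.integral_add (Continuous.intervalIntegrable (by fun_prop) _ _)
    (Continuous.intervalIntegrable (by fun_prop) _ _), ← intervalIntegral.integral_div]
  refine intervalIntegral.integral_congr fun t _ => ?_
  rw [sub_mul, add_mul, cos_sub, cos_add]
  ring

lemma cosTransform_negReLogDeriv_mul_triWeight_nonneg {σ V T : ℝ} (hσ : 1 < σ) (hV : 0 < V)
    (hVT : V ≤ T) (l : ℝ) :
    0 ≤ cosTransform T (fun t => negReLogDeriv σ t * triWeight V t) l := by
  have hc := continuous_triWeight V
  have h := hasSum_integral_negReLogDeriv_mul (T := T) hσ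
    (W := fun t => triWeight V t * cos (l * t)) (by fun_prop)
  simp only [cosTransform, mul_assoc]
  refine h.nonneg fun n => ?_
  rw [cosTransform_triWeight_mul_cos]
  have h1 := cosTransform_triWeight_nonneg hV hVT (log n - l)
  have h2 := cosTransform_triWeight_nonneg hV hVT (log n + l)
  have h3 : 0 ≤ Λ n := vonMangoldt_nonneg
  positivity

/-- The cosine transforms of `-Re ζ'/ζ(σ + it)` against a triangular weight of length `V` are
`O(V)`, uniformly in the frequency and in `σ > 1`. This replaces any pointwise bound for `ζ'/ζ`
near the line `Re s = 1`: only positivity and Chebyshev's estimate enter. -/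
lemma exists_cosTransform_negReLogDeriv_mul_triWeight_le :
    ∃ C : ℝ, 0 ≤ C ∧ ∀ σ V T l : ℝ, 1 < σ → 1 ≤ V → V ≤ T →
      cosTransform T (fun t => negReLogDeriv σ t * triWeight V t) l ≤ C * V := by
  obtain ⟨B, hB0, hB⟩ := exists_sum_vonMangoldt_div_mul_le
  refine ⟨5 * B, by positivity, fun σ V T l hσ hV hVT => ?_⟩
  have hc := continuous_triWeight V
  have h := hasSum_integral_negReLogDeriv_mul (T := T) hσ
    (W := fun t => triWeight V t * cos (l * t)) (by fun_prop)
  have e : cosTransform T (fun t => negReLogDeriv σ t * triWeight V t) l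
      = ∫ t in (0 : ℝ)..T, negReLogDeriv σ t * (triWeight V t * cos (l * t)) := by
    simp only [cosTransform, mul_assoc]
  rw [e]
  refine hasSum_le_of_sum_le h fun s => ?_
  have hterm : ∀ n ∈ s, Λ n * (n : ℝ) ^ (-σ)
        * cosTransform T (fun t => triWeight V t * cos (l * t)) (log n)
      ≤ 5 * V / 2 * (Λ n / n * (1 / (1 + (log n - l) ^ 2))
        + Λ n / n * (1 / (1 + (log n - -l) ^ 2))) := by
    intro n _
    rcases Nat.eq_zero_or_pos n with rfl | hn
    · simp
    have hn' : (1 : ℝ) ≤ n := by exact_mod_cast hn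
    have h1 : (n : ℝ) ^ (-σ) ≤ (n : ℝ)⁻¹ := by
      rw [← rpow_neg_one]
      exact rpow_le_rpow_of_exponent_le hn' (by linarith)
    have h2 : cosTransform T (fun t => triWeight V t * cos (l * t)) (log n)
        ≤ 5 * V / 2 * (1 / (1 + (log n - l) ^ 2) + 1 / (1 + (log n - -l) ^ 2)) := by
      rw [cosTransform_triWeight_mul_cos, sub_neg_eq_add]
      have a1 := cosTransform_triWeight_le hV hVT (log n - l)
      have a2 := cosTransform_triWeight_le hV hVT (log n + l)
      rw [div_eq_mul_one_div] at a1 a2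
      linarith
    have h3 : 0 ≤ Λ n := vonMangoldt_nonneg
    calc _ ≤ Λ n * (n : ℝ) ^ (-σ)
          * (5 * V / 2 * (1 / (1 + (log n - l) ^ 2) + 1 / (1 + (log n - -l) ^ 2))) := by gcongr
      _ ≤ Λ n * (n : ℝ)⁻¹
          * (5 * V / 2 * (1 / (1 + (log n - l) ^ 2) + 1 / (1 + (log n - -l) ^ 2))) := by gcongr
      _ = _ := by ring
  refine (Finset.sum_le_sum hterm).trans ?_
  rw [← Finset.mul_sum, Finset.sum_add_distrib]
  have := mul_le_mul_of_nonneg_left (add_le_add (hB s l) (hB s (-l)))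
    (by positivity : 0 ≤ 5 * V / 2)
  linarith

end ZetaLogDeriv

/-! ### Resonance -/

section Resonance

open Real Filter Topology Finset
open ArithmeticFunction hiding log id

/-- The parameters `1 - p / N` of the Poisson kernels in the resonator. -/
noncomputable def resParam (N p : ℕ) : ℝ := 1 - p / N

lemma resParam_mem {N p : ℕ} (hp : p ∈ primesTo N) : 0 ≤ resParam N p ∧ resParam N p < 1 := by
  rw [mem_primesTo] at hp
  have hp0 : (0 : ℝ) < p := by exact_mod_cast hp.1.pos
  have hpN : (p : ℝ) ≤ N := by exact_mod_cast hp.2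
  have hN : (0 : ℝ) < N := hp0.trans_le hpN
  exact ⟨sub_nonneg.2 ((div_le_one hN).2 hpN), sub_lt_self _ (by positivity)⟩

lemma prod_resParam_eq {N : ℕ} :
    ∏ p ∈ primesTo N, ((1 + resParam N p) / (1 - resParam N p))
      = exp (∑ p ∈ primesTo N, log ((2 * N - p) / p)) := by
  rw [exp_sum]
  refine Finset.prod_congr rfl fun p hp => ?_
  rw [mem_primesTo] at hp
  have hp0 : (0 : ℝ) < p := by exact_mod_cast hp.1.pos
  have hpN : (p : ℝ) ≤ N := by exact_mod_cast hp.2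
  have hN : (0 : ℝ) < N := hp0.trans_le hpN
  rw [exp_log (div_pos (by linarith) hp0), resParam, sub_sub_cancel]
  field_simp
  ring

/-- Each prime power `n ≤ N` is amplified by the resonator by the factor `1 - n / N`. -/
lemma mul_cosTransform_resonator_le {T : ℝ} (hT : 0 ≤ T) {W : ℝ → ℝ} (hW : Continuous W)
    (h : ∀ l, 0 ≤ cosTransform T W l) {N n : ℕ} (hn : n ≤ N) (hΛ : IsPrimePow n) :
    (1 - n / N) * cosTransform T (fun t => W t * resonator (primesTo N) (resParam N) t) 0
      ≤ cosTransform T (fun t => W t * resonator (primesTo N) (resParam N) t) (log n) := by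
  obtain ⟨p, k, hp, hk, rfl⟩ := (isPrimePow_nat_iff n).1 hΛ
  have hpN : p ≤ N := (Nat.le_self_pow hk.ne' p).trans hn
  have hmem : p ∈ primesTo N := mem_primesTo.2 ⟨hp, hpN⟩
  have hN : (0 : ℝ) < N := by exact_mod_cast hp.pos.trans_le hpN
  refine le_trans ?_ (pow_mul_cosTransform_resonator_le hT hW (fun _ => resParam_mem) h hmem k)
  refine mul_le_mul_of_nonneg_right ?_
    (cosTransform_resonator_nonneg hT hW (fun _ => resParam_mem) h 0)
  have hb := one_add_mul_le_pow (a := -((p : ℝ) / N)) (by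
    have : (p : ℝ) / N ≤ 1 := (div_le_one hN).2 (by exact_mod_cast hpN)
    linarith) k
  refine le_trans ?_ (hb.trans (le_of_eq (by rw [resParam, sub_eq_add_neg])))
  have hkp : k * p ≤ p ^ k := by
    obtain ⟨j, rfl⟩ : ∃ j, k = j + 1 := ⟨k - 1, by omega⟩
    rw [pow_succ]
    exact Nat.mul_le_mul_right p (Nat.lt_pow_self hp.one_lt)
  have hkp' : (k : ℝ) * p ≤ ((p ^ k : ℕ) : ℝ) := by exact_mod_cast hkp
  have : (k : ℝ) * p / N ≤ ((p ^ k : ℕ) : ℝ) / N := by gcongr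
  linarith [mul_div_assoc (k : ℝ) p N]

/-- A combination of four triangular weights that vanishes on `[0, U]` and lies between `0` and
`triWeight T` on `[0, T]`. -/
noncomputable def gapWeight (U T t : ℝ) : ℝ :=
  triWeight T t - U / T * triWeight U t
    - (1 - U / T) * (2 * triWeight (2 * U) t - triWeight U t)

lemma gapWeight_eq_zero {U T t : ℝ} (hU : 0 < U) (hUT : 2 * U ≤ T) (ht : t ≤ U) :
    gapWeight U T t = 0 := by
  have hT : 0 < T := by linarith
  rw [gapWeight, triWeight_of_le hT (by linarith), triWeight_of_le hU ht,
    triWeight_of_le (by linarith : 0 < 2 * U) (by linarith)]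
  field_simp
  ring

lemma gapWeight_mem {U T t : ℝ} (hU : 0 < U) (hUT : 2 * U ≤ T) (ht : U ≤ t) (htT : t ≤ T) :
    0 ≤ gapWeight U T t ∧ gapWeight U T t ≤ triWeight T t := by
  have hT : 0 < T := by linarith
  have hUT' : U / T ≤ 1 / 2 := by rw [div_le_iff₀ hT]; linarith
  rw [gapWeight, triWeight_of_ge hU ht]
  have h2 := triWeight_nonneg (2 * U) t
  constructor
  · rcases le_total t (2 * U) with h | h
    · rw [triWeight_of_le hT htT, triWeight_of_le (by linarith : 0 < 2 * U) h]
      have : 1 - t / T - U / T * 0 - (1 - U / T) * (2 * (1 - t / (2 * U)) - 0)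
          = (t / U - 1) * (1 - 2 * (U / T)) := by
        field_simp; ring
      rw [this]
      exact mul_nonneg (sub_nonneg.2 ((one_le_div hU).2 ht)) (by linarith)
    · rw [triWeight_of_ge (by linarith : 0 < 2 * U) h]
      simpa using triWeight_nonneg T t
  · have : 0 ≤ (1 - U / T) * (2 * triWeight (2 * U) t) := mul_nonneg (by linarith) (by linarith)
    linarith

lemma continuous_gapWeight (U T : ℝ) : Continuous (gapWeight U T) := by
  have h1 := continuous_triWeight U
  have h2 := continuous_triWeight (2 * U)
  have h3 := continuous_triWeight T
  unfold gapWeight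
  fun_prop

lemma sum_mul_integral_resonator_le {σ T : ℝ} (hσ : 1 < σ) (hT : 0 < T) (N : ℕ) :
    (∑ n ∈ Ico 1 (N + 1), Λ n * (n : ℝ) ^ (-σ) * (1 - n / N))
        * (∫ t in (0 : ℝ)..T, triWeight T t * resonator (primesTo N) (resParam N) t)
      ≤ ∫ t in (0 : ℝ)..T,
          negReLogDeriv σ t * (triWeight T t * resonator (primesTo N) (resParam N) t) := by
  have hR := continuous_resonator (S := primesTo N) (q := resParam N) fun _ => resParam_mem
  have hc := continuous_triWeight T
  have h := hasSum_integral_negReLogDeriv_mul (T := T) hσ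
    (W := fun t => triWeight T t * resonator (primesTo N) (resParam N) t) (by fun_prop)
  have htri := cosTransform_triWeight_nonneg hT le_rfl
  have h0 : ∫ t in (0 : ℝ)..T, triWeight T t * resonator (primesTo N) (resParam N) t
      = cosTransform T (fun t => triWeight T t * resonator (primesTo N) (resParam N) t) 0 := by
    simp [cosTransform]
  rw [h0, Finset.sum_mul]
  refine le_trans (Finset.sum_le_sum fun n hn => ?_) (sum_le_hasSum (Ico 1 (N + 1))
    (fun n _ => mul_nonneg (mul_nonneg vonMangoldt_nonneg (by positivity))
      (cosTransform_resonator_nonneg hT.le hc (fun _ => resParam_mem) htri _)) h)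
  by_cases hΛ : IsPrimePow n
  · rw [mul_assoc]
    refine mul_le_mul_of_nonneg_left ?_ (mul_nonneg vonMangoldt_nonneg (by positivity))
    exact mul_cosTransform_resonator_le hT.le hc htri
      (Nat.lt_succ_iff.1 (Finset.mem_Ico.1 hn).2) hΛ
  · simp [vonMangoldt_eq_zero_iff.2 hΛ]

/-- The resonance inequality to the right of the line `Re s = 1`. -/
lemma exists_le_negReLogDeriv_of_one_lt : ∃ C : ℝ, 0 ≤ C ∧ ∀ (σ U T m : ℝ) (N : ℕ), 1 < σ →
    1 ≤ U → 2 * U ≤ T → 0 < m →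
    m ≤ ∑ n ∈ Ico 1 (N + 1), Λ n * (n : ℝ) ^ (-σ) * (1 - n / N)
      - C * (U / T) * exp (∑ p ∈ primesTo N, log ((2 * N - p) / p)) →
    ∃ t ∈ Set.Icc U T, m ≤ negReLogDeriv σ t := by
  obtain ⟨C, hC0, hC⟩ := exists_cosTransform_negReLogDeriv_mul_triWeight_le
  refine ⟨8 * C, by positivity, fun σ U T m N hσ hU hUT hm0 hm => ?_⟩
  have hU0 : 0 < U := by linarith
  have hT0 : 0 < T := by linarith
  have hUT1 : U ≤ T := by linarith
  have hq := fun (p : ℕ) (hp : p ∈ primesTo N) => resParam_mem hp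
  have hR := continuous_resonator hq
  have hR0 := resonator_nonneg hq
  have hf := continuous_negReLogDeriv hσ
  have hcK := continuous_gapWeight U T
  have hcT := continuous_triWeight T
  set R := resonator (primesTo N) (resParam N) with hRdef
  set E := exp (∑ p ∈ primesTo N, log ((2 * N - p) / p)) with hE
  set D := ∑ n ∈ Ico 1 (N + 1), Λ n * (n : ℝ) ^ (-σ) * (1 - n / N) with hD
  set A := ∫ t in (0 : ℝ)..T, triWeight T t * R t with hA
  set I : ℝ → ℝ := fun V => ∫ t in (0 : ℝ)..T, negReLogDeriv σ t * (triWeight V t * R t) with hI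
  have hItrans : ∀ V, I V
      = cosTransform T (fun t => negReLogDeriv σ t * triWeight V t * R t) 0 := by
    intro V; simp [hI, cosTransform, mul_assoc]
  have hfc : ∀ V, Continuous fun t => negReLogDeriv σ t * triWeight V t := fun V =>
    hf.mul (continuous_triWeight V)
  have hI0 : ∀ V, 0 < V → V ≤ T → 0 ≤ I V := fun V hV hVT => by
    rw [hItrans]
    exact cosTransform_resonator_nonneg hT0.le (hfc V) hq
      (cosTransform_negReLogDeriv_mul_triWeight_nonneg hσ hV hVT) 0
  have hI2 : I (2 * U) ≤ C * (2 * U) * E := by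
    rw [hItrans, hE, ← prod_resParam_eq]
    exact cosTransform_resonator_le hT0.le (hfc _) hq
      (fun l => hC σ (2 * U) T l hσ (by linarith) hUT) 0
  have hID : D * A ≤ I T := sum_mul_integral_resonator_le hσ hT0 N
  have hA1 : T / 2 ≤ A := by
    have := cosTransform_le_cosTransform_resonator hT0.le hcT hq
      (cosTransform_triWeight_nonneg hT0 le_rfl) 0
    rw [cosTransform_triWeight_zero hT0 le_rfl] at this
    simpa [cosTransform, hA] using this
  have hA0 : 0 < A := by linarith
  -- The part of the integral over `[0, U]` is removed at the cost of `O(U)` times the maximum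
  -- of the resonator.
  have hIK : ∫ t in (0 : ℝ)..T, negReLogDeriv σ t * (gapWeight U T t * R t)
      = I T - U / T * I U - (1 - U / T) * (2 * I (2 * U) - I U) := by
    have hi : ∀ V, IntervalIntegrable (fun t => negReLogDeriv σ t * (triWeight V t * R t))
        MeasureTheory.volume 0 T := fun V => by
      have := continuous_triWeight V
      exact Continuous.intervalIntegrable (by fun_prop) _ _
    simp only [hI]
    rw [← intervalIntegral.integral_const_mul, ← intervalIntegral.integral_const_mul,
      ← intervalIntegral.integral_sub ((hi _).const_mul _) (hi _),
      ← intervalIntegral.integral_const_mul,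
      ← intervalIntegral.integral_sub (hi _) ((hi _).const_mul _),
      ← intervalIntegral.integral_sub ((hi _).sub ((hi _).const_mul _))
        ((((hi _).const_mul _).sub (hi _)).const_mul _)]
    refine intervalIntegral.integral_congr fun t _ => ?_
    simp only [gapWeight]
    ring
  have hUT2 : U / T ≤ 1 / 2 := by rw [div_le_iff₀ hT0]; linarith
  have hUTpos : 0 < U / T := by positivity
  have hlow : m * A ≤ ∫ t in (0 : ℝ)..T, negReLogDeriv σ t * (gapWeight U T t * R t) := by
    rw [hIK]
    have h1 : 0 ≤ (1 - 2 * (U / T)) * I U := mul_nonneg (by linarith) (hI0 U hU0 hUT1)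
    have h2 : (1 - U / T) * (2 * I (2 * U)) ≤ 4 * C * U * E := by
      have := hI0 (2 * U) (by linarith) hUT
      nlinarith
    have h3 : 4 * C * U * E ≤ 8 * C * (U / T) * E * A := by
      have h4 : 0 ≤ 8 * C * (U / T) * E := by positivity
      have h5 := mul_le_mul_of_nonneg_left hA1 h4
      refine le_trans (le_of_eq ?_) h5
      field_simp; ring
    have h6 := mul_le_mul_of_nonneg_right hm hA0.le
    linarith
  by_contra! hcon
  have hKA : ∫ t in (0 : ℝ)..T, gapWeight U T t * R t ≤ A := by
    refine intervalIntegral.integral_mono_on hT0.le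
      (Continuous.intervalIntegrable (by fun_prop) _ _)
      (Continuous.intervalIntegrable (by fun_prop) _ _) fun t ht => ?_
    refine mul_le_mul_of_nonneg_right ?_ (hR0 t)
    rcases le_total t U with h | h
    · rw [gapWeight_eq_zero hU0 hUT h]; exact triWeight_nonneg _ _
    · exact (gapWeight_mem hU0 hUT h ht.2).2
  obtain ⟨x, hx, hmax⟩ := (isCompact_Icc (a := U) (b := T)).exists_isMaxOn
    (Set.nonempty_Icc.2 hUT1) hf.continuousOn
  have hxm := hcon x hx
  have hup : ∫ t in (0 : ℝ)..T, negReLogDeriv σ t * (gapWeight U T t * R t)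
      ≤ negReLogDeriv σ x * ∫ t in (0 : ℝ)..T, gapWeight U T t * R t := by
    rw [← intervalIntegral.integral_const_mul]
    refine intervalIntegral.integral_mono_on hT0.le
      (Continuous.intervalIntegrable (by fun_prop) _ _)
      (Continuous.intervalIntegrable (by fun_prop) _ _) fun t ht => ?_
    rcases le_total t U with h | h
    · rw [gapWeight_eq_zero hU0 hUT h]; simp
    · exact mul_le_mul_of_nonneg_right (hmax ⟨h, ht.2⟩)
        (mul_nonneg (gapWeight_mem hU0 hUT h ht.2).1 (hR0 t))
  have hK0 : 0 ≤ ∫ t in (0 : ℝ)..T, gapWeight U T t * R t := by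
    refine intervalIntegral.integral_nonneg hT0.le fun t ht => mul_nonneg ?_ (hR0 t)
    rcases le_total t U with h | h
    · rw [gapWeight_eq_zero hU0 hUT h]
    · exact (gapWeight_mem hU0 hUT h ht.2).1
  have hfin := hlow.trans hup
  have hmA : 0 < m * A := by positivity
  rcases le_or_gt (negReLogDeriv σ x) 0 with hx0 | hx0
  · linarith [mul_nonpos_of_nonpos_of_nonneg hx0 hK0]
  · have h1 := mul_le_mul_of_nonneg_left hKA hx0.le
    have h2 := mul_lt_mul_of_pos_right hxm hA0
    linarith

/-- The resonance inequality on the line `Re s = 1`, by letting `σ` decrease to `1`. -/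
lemma exists_le_negReLogDeriv_one : ∃ C : ℝ, 0 ≤ C ∧ ∀ (U T m : ℝ) (N : ℕ),
    1 ≤ U → 2 * U ≤ T → 0 < m →
    m < ∑ n ∈ Ico 1 (N + 1), Λ n / n * (1 - n / N)
      - C * (U / T) * exp (∑ p ∈ primesTo N, log ((2 * N - p) / p)) →
    ∃ t ∈ Set.Icc U T, m ≤ negReLogDeriv 1 t := by
  obtain ⟨C, hC0, hC⟩ := exists_le_negReLogDeriv_of_one_lt
  refine ⟨C, hC0, fun U T m N hU hUT hm0 hm => ?_⟩
  set s : ℕ → ℝ := fun j => 1 + 1 / ((j : ℝ) + 1) with hs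
  have hs1 : ∀ j, 1 < s j := fun j => by
    have : 0 < 1 / ((j : ℝ) + 1) := by positivity
    simp only [hs]; linarith
  have hslim : Tendsto s atTop (𝓝 1) := by
    simpa [hs] using tendsto_one_div_add_atTop_nhds_zero_nat.const_add (1 : ℝ)
  have hsum : Tendsto (fun j => ∑ n ∈ Ico 1 (N + 1), Λ n * (n : ℝ) ^ (-s j) * (1 - n / N)) atTop
      (𝓝 (∑ n ∈ Ico 1 (N + 1), Λ n / n * (1 - n / N))) := by
    refine tendsto_finsetSum _ fun n hn => ?_
    have hn0 : (n : ℝ) ≠ 0 := by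
      have := (Finset.mem_Ico.1 hn).1
      exact_mod_cast (by omega : n ≠ 0)
    have h1 : Tendsto (fun j => (n : ℝ) ^ (-s j)) atTop (𝓝 ((n : ℝ) ^ (-1 : ℝ))) :=
      (continuousAt_const_rpow hn0).tendsto.comp hslim.neg
    rw [rpow_neg_one] at h1
    rw [div_eq_mul_inv]
    exact (h1.const_mul _).mul_const _
  obtain ⟨j₀, hj₀⟩ := eventually_atTop.1
    ((hsum.sub_const (C * (U / T) * exp (∑ p ∈ primesTo N, log ((2 * N - p) / p)))).eventually
      (lt_mem_nhds hm))
  have hex : ∀ j, ∃ t ∈ Set.Icc U T, m ≤ negReLogDeriv (s (j + j₀)) t := fun j =>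
    hC _ U T m N (hs1 _) hU hUT hm0 (hj₀ _ (Nat.le_add_left _ _)).le
  choose t htmem ht using hex
  obtain ⟨x, hx, φ, hφ, hlim⟩ := isCompact_Icc.tendsto_subseq htmem
  refine ⟨x, hx, ?_⟩
  have hx0 : x ≠ 0 := by linarith [hx.1]
  have hpair : Tendsto (fun j => (s (φ j + j₀), t (φ j))) atTop (𝓝 (1, x)) :=
    ((hslim.comp ((tendsto_add_atTop_nat j₀).comp hφ.tendsto_atTop)).prodMk_nhds hlim)
  exact ge_of_tendsto' ((continuousAt_negReLogDeriv le_rfl (Or.inr hx0)).tendsto.comp hpair)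
    fun j => ht (φ j)

lemma negReLogDeriv_one (t : ℝ) : negReLogDeriv 1 t = -(zetaLogDerivOneLine t).re := by
  simp [negReLogDeriv, zetaLogDerivOneLine]

lemma continuousOn_zetaLogDerivOneLine {U T : ℝ} (hU : 0 < U) :
    ContinuousOn zetaLogDerivOneLine (Set.Icc U T) := by
  intro t ht
  have ht0 : t ≠ 0 := by linarith [ht.1]
  have hs : (1 + Complex.I * t : ℂ) ≠ 1 := by simp [ht0]
  have ha := analyticOn_riemannZeta _ hs
  have hc : ContinuousAt (fun s : ℂ => deriv riemannZeta s / riemannZeta s)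
      (1 + Complex.I * t) := ha.deriv.continuousAt.div ha.continuousAt
        (riemannZeta_ne_zero_of_one_le_re (by simp))
  exact (ContinuousAt.comp (f := fun t : ℝ => (1 + Complex.I * t : ℂ)) hc
    (by fun_prop)).continuousWithinAt

lemma eventually_exists_le_neg_re {β ε : ℝ} (hβ : β ∈ Set.Ioo (0 : ℝ) 1) (hε : 0 < ε) :
    ∀ᶠ T : ℝ in atTop, 1 ≤ T ^ β ∧ ∃ t ∈ Set.Icc (T ^ β) T,
      log (log T) + log (log (log T)) + zetaConst β - ε ≤ -(zetaLogDerivOneLine t).re := by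
  obtain ⟨C, hC0, hC⟩ := exists_le_negReLogDeriv_one
  obtain ⟨ρ, hρ, hN⟩ := exists_resonator_length hβ.2 (half_pos hε)
  have hLL : Tendsto (fun T : ℝ => log (log T)) atTop atTop :=
    tendsto_log_atTop.comp tendsto_log_atTop
  have hmain : Tendsto (fun T : ℝ => log (log T) + log (log (log T)) + (zetaConst β - ε)) atTop
      atTop :=
    tendsto_atTop_add_const_right _ _ (hLL.atTop_add_atTop (tendsto_log_atTop.comp hLL))
  have herr : Tendsto (fun T : ℝ => C * T ^ (-(1 - β - ρ))) atTop (𝓝 0) := by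
    simpa using (tendsto_rpow_neg_atTop (sub_pos.2 hρ)).const_mul C
  filter_upwards [hN, hmain.eventually_gt_atTop 0, herr.eventually (gt_mem_nhds (half_pos hε)),
    (tendsto_rpow_atTop (sub_pos.2 hβ.2)).eventually_ge_atTop 2, eventually_ge_atTop 1]
    with T ⟨N, _, hN1, hN2⟩ hpos herrT hT2 hT1
  have hT0 : 0 < T := by linarith
  have hU : 1 ≤ T ^ β := one_le_rpow hT1 hβ.1.le
  have hUT : 2 * T ^ β ≤ T := by
    have : T ^ (1 - β) * T ^ β = T := by rw [← rpow_add hT0]; simp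
    nlinarith [rpow_pos_of_pos hT0 β]
  refine ⟨hU, ?_⟩
  have hexp : exp (∑ p ∈ primesTo N, log ((2 * N - p) / p)) ≤ T ^ ρ := by
    rw [rpow_def_of_pos hT0, mul_comm (log T)]
    exact exp_le_exp.2 hN1
  have herr2 : C * (T ^ β / T) * exp (∑ p ∈ primesTo N, log ((2 * N - p) / p)) < ε / 2 := by
    refine lt_of_le_of_lt ?_ herrT
    have e : T ^ (-(1 - β - ρ)) = T ^ β / T * T ^ ρ := by
      rw [show -(1 - β - ρ) = β - 1 + ρ by ring, rpow_add hT0, rpow_sub hT0, rpow_one]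
    rw [e, ← mul_assoc]
    gcongr
  obtain ⟨t, ht, hle⟩ := hC (T ^ β) T (log (log T) + log (log (log T)) + zetaConst β - ε) N hU hUT
    (by linarith) (by linarith)
  exact ⟨t, ht, negReLogDeriv_one t ▸ hle⟩

end Resonance

theorem theorem1 (β ε : ℝ) (hβ : β ∈ Set.Ioo (0 : ℝ) 1) (hε : ε ∈ Set.Ioo (0 : ℝ) 1) :
    (∀ᶠ T : ℝ in Filter.atTop,
      ∃ M : ℝ,
        IsGreatest ((fun t : ℝ => -(zetaLogDerivOneLine t).re) '' Set.Icc (T ^ β) T) M ∧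
        Real.log (Real.log T) + Real.log (Real.log (Real.log T)) + zetaConst β - ε ≤ M) ∧
    (∀ᶠ T : ℝ in Filter.atTop,
      ∃ M : ℝ,
        IsGreatest ((fun t : ℝ => ‖zetaLogDerivOneLine t‖) '' Set.Icc (T ^ β) T) M ∧
        Real.log (Real.log T) + Real.log (Real.log (Real.log T)) + zetaConst β - ε ≤ M) := by
  have h := eventually_exists_le_neg_re hβ hε.1
  constructor
  · filter_upwards [h] with T hT
    obtain ⟨hU, t, ht, hle⟩ := hT
    obtain ⟨x, hx, hmax⟩ := isCompact_Icc.exists_isMaxOn ⟨t, ht⟩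
      (Complex.continuous_re.comp_continuousOn
        (continuousOn_zetaLogDerivOneLine (T := T) (zero_lt_one.trans_le hU))).neg
    refine ⟨_, ⟨⟨x, hx, rfl⟩, ?_⟩, hle.trans (hmax ht)⟩
    rintro _ ⟨y, hy, rfl⟩
    exact hmax hy
  · filter_upwards [h] with T hT
    obtain ⟨hU, t, ht, hle⟩ := hT
    obtain ⟨x, hx, hmax⟩ := isCompact_Icc.exists_isMaxOn ⟨t, ht⟩
      (continuousOn_zetaLogDerivOneLine (T := T) (zero_lt_one.trans_le hU)).norm
    refine ⟨_, ⟨⟨x, hx, rfl⟩, ?_⟩, ?_⟩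
    · rintro _ ⟨y, hy, rfl⟩
      exact hmax hy
    · exact (hle.trans ((neg_le_abs _).trans (Complex.abs_re_le_norm _))).trans (hmax ht)
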